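/- **Setting.** Let $n$ tasks (clients) be given by probability distributions $\mathbf D_1,\dots,\mathbf D_n$ of data and loss functions $\ell_i(\mathbf w,\mathbf z)$, $\mathbf w\in\mathbb R^d$, twice differentiable in $\mathbf w$. Put $\mathcal L_i(\mathbf w)=\mathbb E_{\mathbf z\sim\mathbf D_i}[\ell_i(\mathbf w,\mathbf z)]$ and, for a fixed $\alpha\ge 0$, $$F(\mathbf w)=\frac1n\sum_{i=1}^n\mathcal L_i\big(\mathbf w-\alpha\nabla\mathcal L_i(\mathbf w)\big).$$ Assume for all $i$ and all $\mathbf w,\mathbf w'\in\mathbb R^d$ (Euclidean and spectral norms): $\mathcal L_i$ is twice differentiable; $\|\nabla\mathcal L_i(\mathbf w)-\nabla\mathcal L_i(\mathbf w')\|\le L\|\mathbf w-\mathbf w'\|$; $\|\nabla^2\mathcal L_i(\mathbf w)-\nabla^2\mathcal L_i(\mathbf w')\|\le\rho\|\mathbf w-\mathbf w'\|$; $\|\nabla\mathcal L_i(\mathbf w)\|\le G$; the stochastic gradient $\nabla\ell_i(\mathbf w;\mathbf z)$ and Hessian $\nabla^2\ell_i(\mathbf w;\mathbf z)$, $\mathbf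 z\sim\mathbf D_i$, are unbiased for $\nabla\mathcal L_i(\mathbf w)$ and $\nabla^2\mathcal L_i(\mathbf w)$, with variances $\mathbb E\|\nabla\ell_i(\mathbf w;\mathbf z)-\nabla\mathcal L_i(\mathbf w)\|^2\le\sigma_G^2$ and $\mathbb E\|\nabla^2\ell_i(\mathbf w;\mathbf z)-\nabla^2\mathcal L_i(\mathbf w)\|^2\le\sigma_H^2$; and $F$ is bounded below. **LocalMOML with client sampling** (parameters $\beta,\eta,B,H,K,K_0,R$). Start from $\mathbf w_1\in\mathbb R^d$. In round $r=1,\dots,R$ a set $\mathcal B_r$ of $B<n$ clients is selected uniformly at random. Every client $i\in\mathcal B_r$ sets $\mathbf w^i_{r,1}=\mathbf w_r$, draws a batch $\mathcal S_0^i$ of $K_0$ points from $\mathbf D_i$, and restarts its personalized model at $\mathbf u^i_{r,0}=\mathbf w_r-\alpha\widehat\nabla_{\mathcal S_0^i}\mathcal L_i(\mathbf w_r)$. For $h=1,\dots,H$ it then draws three batches $\mathcal S_1^i,\mathcal S_2^i,\mathcal S_3^i$ of $K$ points from $\mathbf D_i$ and sets $$\mathbf u^i_{r,h}=(1-\beta)\mathbf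 u^i_{r,h-1}+\beta\big(\mathbf w^i_{r,h}-\alpha\widehat\nabla_{\mathcal S_1^i}\mathcal L_i(\mathbf w^i_{r,h})\big),\qquad \mathbf w^i_{r,h+1}=\mathbf w^i_{r,h}-\eta\big(I-\alpha\widehat\nabla^2_{\mathcal S_2^i}\mathcal L_i(\mathbf w^i_{r,h})\big)\widehat\nabla_{\mathcal S_3^i}\mathcal L_i(\mathbf u^i_{r,h}).$$ Finally $\mathbf w_{r+1}=\frac1B\sum_{i\in\mathcal B_r}\mathbf w^i_{r,H+1}$. Here $\widehat\nabla_{\mathcal S}\mathcal L_i$ and $\widehat\nabla^2_{\mathcal S}\mathcal L_i$ are the averages of $\nabla\ell_i(\cdot;\mathbf z)$ and $\nabla^2\ell_i(\cdot;\mathbf z)$ over $\mathbf z\in\mathcal S$, and all data points and client selections are independent. **Statement.** Let $\alpha,L,\rho,\sigma_G,\sigma_H,G,\Delta\ge 0$ and integers $B,K\ge 1$ be given. There are constants $c_\beta\in(0,1]$ and $c_\eta,c_H,c_R,C>0$, depending only on these quantities, such that the following holds for all $d$, all $n>B$, all problems as above, all $\mathbf w_1$ with $F(\mathbf w_1)-\inf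 F\le\Delta$ and all $\epsilon\in(0,1]$. Run LocalMOML with client sampling with $$\beta=c_\beta\epsilon^2,\quad \eta=c_\eta\epsilon^4,\quad H=\lceil c_H\epsilon^{-2}\rceil,\quad K_0=H,\quad R=\lceil c_R\epsilon^{-4}\rceil .$$ Then: 1. $\frac1R\sum_{r=1}^R\mathbb E\|\nabla F(\mathbf w_r)\|^2\le\epsilon^2$, all these expectations being finite. Also $\frac1R\sum_{r=1}^R\mathbb E\|\nabla F(\mathbf w_r)\|\le\epsilon$ (so a model drawn uniformly from $\mathbf w_1,\dots,\mathbf w_R$ is an $\epsilon$-stationary solution), and $\mathbb E\|\nabla F(\mathbf w_r)\|\le\epsilon$ for some $r\le R$. 2. The number of communication rounds satisfies $R\le C\epsilon^{-4}$, and the number of iterations $T=RH$ satisfies $T\le C\epsilon^{-6}$. 3. The average number of data points per iteration of a selected client is $(K_0+3HK)/H=1+3K$. Almost surely, the number of data points drawn by the selected clients during the $R$ rounds is, on average per iteration, $B(1+3K)=\mathcal O(1)$ and, in total, at most $C\epsilon^{-6}$. -/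

import Mathlib

open MeasureTheory ProbabilityTheory

namespace LocalMOML

/-- The parameter space `ℝ^d` with the Euclidean norm. -/
abbrev Vec (d : ℕ) : Type := EuclideanSpace ℝ (Fin d)

/-- The Hessian of `f`, as the derivative of the gradient field; its operator norm is the
spectral norm. -/
noncomputable def hess {d : ℕ} (f : Vec d → ℝ) (w : Vec d) : Vec d →L[ℝ] Vec d :=
  fderiv ℝ (fun x => gradient f x) w

section Problem

variable {d n : ℕ} {Z : Type*} [MeasurableSpace Z]

/-- The risk of task `i`: the expectation of `ℓ i w z` over `z ∼ D i`. -/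
noncomputable def risk (D : Fin n → Measure Z) (ℓ : Fin n → Vec d → Z → ℝ) (i : Fin n)
    (w : Vec d) : ℝ :=
  ∫ z, ℓ i w z ∂(D i)

/-- The MAML objective `F(w) = (1/n) ∑ i, L_i (w - α ∇L_i(w))`. -/
noncomputable def metaObjective (D : Fin n → Measure Z) (ℓ : Fin n → Vec d → Z → ℝ) (α : ℝ)
    (w : Vec d) : ℝ :=
  (n : ℝ)⁻¹ * ∑ i, risk D ℓ i (w - α • gradient (risk D ℓ i) w)

/-- The standing assumptions on the tasks: the losses are twice differentiable in the parameter and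
suitably measurable, the stochastic gradient and Hessian are unbiased with variance at most
`σG ^ 2` and `σH ^ 2`, every risk is twice differentiable with `L`-Lipschitz gradient,
`ρ`-Lipschitz Hessian and gradient bounded by `G`, and the MAML objective is bounded below. -/
structure Assumptions (D : Fin n → Measure Z) (ℓ : Fin n → Vec d → Z → ℝ)
    (α L ρ σG σH G : ℝ) : Prop where
  integrable_loss : ∀ i w, Integrable (ℓ i w) (D i)
  differentiable_loss : ∀ i z, Differentiable ℝ (fun w => ℓ i w z)
  differentiable_grad_loss : ∀ i z, Differentiable ℝ (gradient (fun w => ℓ i w z))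
  measurable_grad : ∀ i, Measurable (fun p : Vec d × Z => gradient (fun w => ℓ i w p.2) p.1)
  measurable_hess : ∀ i, Measurable (fun p : Vec d × Z => hess (fun w => ℓ i w p.2) p.1)
  integrable_grad : ∀ i w, Integrable (fun z => gradient (fun x => ℓ i x z) w) (D i)
  unbiased_grad : ∀ i w, ∫ z, gradient (fun x => ℓ i x z) w ∂(D i) = gradient (risk D ℓ i) w
  integrable_hess : ∀ i w, Integrable (fun z => hess (fun x => ℓ i x z) w) (D i)
  unbiased_hess : ∀ i w, ∫ z, hess (fun x => ℓ i x z) w ∂(D i) = hess (risk D ℓ i) w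
  integrable_var_grad : ∀ i w,
    Integrable (fun z => ‖gradient (fun x => ℓ i x z) w - gradient (risk D ℓ i) w‖ ^ 2) (D i)
  var_grad_le : ∀ i w,
    ∫ z, ‖gradient (fun x => ℓ i x z) w - gradient (risk D ℓ i) w‖ ^ 2 ∂(D i) ≤ σG ^ 2
  integrable_var_hess : ∀ i w,
    Integrable (fun z => ‖hess (fun x => ℓ i x z) w - hess (risk D ℓ i) w‖ ^ 2) (D i)
  var_hess_le : ∀ i w,
    ∫ z, ‖hess (fun x => ℓ i x z) w - hess (risk D ℓ i) w‖ ^ 2 ∂(D i) ≤ σH ^ 2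
  differentiable_risk : ∀ i, Differentiable ℝ (risk D ℓ i)
  differentiable_grad_risk : ∀ i, Differentiable ℝ (gradient (risk D ℓ i))
  grad_lipschitz : ∀ i w w',
    ‖gradient (risk D ℓ i) w - gradient (risk D ℓ i) w'‖ ≤ L * ‖w - w'‖
  hess_lipschitz : ∀ i w w', ‖hess (risk D ℓ i) w - hess (risk D ℓ i) w'‖ ≤ ρ * ‖w - w'‖
  grad_bounded : ∀ i w, ‖gradient (risk D ℓ i) w‖ ≤ G
  bddBelow : BddBelow (Set.range (metaObjective D ℓ α))

end Problem

section Randomness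

/-- The data points one client draws in one round: `K₀` for the restart, and, in each of its `H`
local iterations, three batches (`S₁`, `S₂`, `S₃`) of `K` points. -/
abbrev Slot (K₀ H K : ℕ) : Type := Fin K₀ ⊕ (Fin H × Fin 3 × Fin K)

/-- Finite sets of clients carry the discrete σ-algebra. -/
instance instMeasurableSpaceClients (n : ℕ) : MeasurableSpace (Finset (Fin n)) := ⊤

/-- The random input of one round: the selected clients, and for every client the data points that
it uses if it is selected (the entries of the other clients are never read). -/
abbrev RoundInput (n K₀ H K : ℕ) (Z : Type*) : Type _ :=
  Finset (Fin n) × (Fin n → Slot K₀ H K → Z)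

/-- The law of the input of one round: a uniformly random set of `B` clients and, independently of
it, independent data points, those of client `i` with law `D i`. -/
noncomputable def roundLaw {n : ℕ} {Z : Type*} [MeasurableSpace Z] (D : Fin n → Measure Z)
    [∀ i, IsProbabilityMeasure (D i)] (B K₀ H K : ℕ) : Measure (RoundInput n K₀ H K Z) :=
  (uniformOn (Finset.powersetCard B (Finset.univ : Finset (Fin n)) : Set (Finset (Fin n)))).prod
    (Measure.pi fun i => Measure.pi fun _ : Slot K₀ H K => D i)

end Randomness

section Algorithm

variable {d n : ℕ} {Z : Type*}

/-- Mini-batch stochastic gradient of the loss `f` over the batch `S`. -/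
noncomputable def stochGrad {K : ℕ} (f : Vec d → Z → ℝ) (S : Fin K → Z) (w : Vec d) : Vec d :=
  (K : ℝ)⁻¹ • ∑ k, gradient (fun x => f x (S k)) w

/-- Mini-batch stochastic Hessian of the loss `f` over the batch `S`. -/
noncomputable def stochHess {K : ℕ} (f : Vec d → Z → ℝ) (S : Fin K → Z) (w : Vec d) :
    Vec d →L[ℝ] Vec d :=
  (K : ℝ)⁻¹ • ∑ k, hess (fun x => f x (S k)) w

/-- The momentum update of the personalized model: `(1-β) u + β (w - α ∇̂_{S₁} L(w))`. -/
noncomputable def personalUpdate {K : ℕ} (f : Vec d → Z → ℝ) (α β : ℝ) (S₁ : Fin K → Z)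
    (w u : Vec d) : Vec d :=
  (1 - β) • u + β • (w - α • stochGrad f S₁ w)

/-- The stochastic meta-gradient `(I - α ∇̂²_{S₂} L(w)) ∇̂_{S₃} L(u)`. -/
noncomputable def metaGrad {K : ℕ} (f : Vec d → Z → ℝ) (α : ℝ) (S₂ S₃ : Fin K → Z)
    (w u : Vec d) : Vec d :=
  (ContinuousLinearMap.id ℝ (Vec d) - α • stochHess f S₂ w) (stochGrad f S₃ u)

/-- One local iteration on the pair (local meta model, personalized model): first the personalized
model is updated, then the local meta model moves along the stochastic meta-gradient computed with
the updated personalized model. -/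
noncomputable def localStep {K : ℕ} (f : Vec d → Z → ℝ) (α β η : ℝ) (S : Fin 3 → Fin K → Z)
    (s : Vec d × Vec d) : Vec d × Vec d :=
  (s.1 - η • metaGrad f α (S 1) (S 2) s.1 (personalUpdate f α β (S 0) s.1 s.2),
    personalUpdate f α β (S 0) s.1 s.2)

/-- The state of a client after `h` local iterations of a round that starts from the meta model
`w`; the personalized model is restarted at `w - α ∇̂_{S₀} L(w)`. -/
noncomputable def clientState {K₀ H K : ℕ} (f : Vec d → Z → ℝ) (α β η : ℝ) (w : Vec d)
    (x : Slot K₀ H K → Z) (h : Fin (H + 1)) : Vec d × Vec d :=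
  Fin.induction (motive := fun _ => Vec d × Vec d)
    (w, w - α • stochGrad f (fun k => x (Sum.inl k)) w)
    (fun h s => localStep f α β η (fun j k => x (Sum.inr (h, j, k))) s) h

/-- One communication round: the local meta models of the selected clients after `H` local
iterations are averaged. -/
noncomputable def round {K₀ H K : ℕ} (ℓ : Fin n → Vec d → Z → ℝ) (α β η : ℝ) (B : ℕ)
    (w : Vec d) (x : RoundInput n K₀ H K Z) : Vec d :=
  (B : ℝ)⁻¹ • ∑ i ∈ x.1, (clientState (ℓ i) α β η w (x.2 i) (Fin.last H)).1

/-- The meta model at the start of each round, given the inputs of the rounds. Rounds are counted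
from `0`, so that `iterate … r` is the paper's model at the start of round `r + 1`. -/
noncomputable def iterate {K₀ H K : ℕ} (ℓ : Fin n → Vec d → Z → ℝ) (α β η : ℝ) (B : ℕ)
    (w₁ : Vec d) (x : ℕ → RoundInput n K₀ H K Z) : ℕ → Vec d
  | 0 => w₁
  | r + 1 => round ℓ α β η B (iterate ℓ α β η B w₁ x r) (x r)

/-- The number of data points drawn by the selected clients during the first `R` rounds. -/
def totalSamples {K₀ H K : ℕ} (x : ℕ → RoundInput n K₀ H K Z) (R : ℕ) : ℕ :=
  ∑ r ∈ Finset.range R, ∑ _i ∈ (x r).1, Fintype.card (Slot K₀ H K)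

end Algorithm

end LocalMOML

namespace LocalMOML

/-! ### Calculus of second-moment bounds. -/

section SecondMoment

variable {Ω E : Type*} [MeasurableSpace Ω] {P : Measure Ω} [NormedAddCommGroup E]

/-! Seen from the server, a round is one inexact stochastic gradient step on `F` with step size `η *
H`. The gradient of `F` is the average over `i` of `(I - α ∇²L_i(w)) ∇L_i(w - α ∇L_i(w))`. It is
bounded and Lipschitz, so `F` changes along a displacement `v` by at most `⟨∇F(w), v⟩ + M ‖v‖²`. Two
facts about the displacement of a round, given its starting model `w`, then suffice.

Size: given the local state, a stochastic meta-gradient is an operator applied to an independent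
vector, both with bounded second moments. Hence `E‖v‖² ≤ m (η H)²`, uniformly in `B` and `n`
(`secondMomentLE_round_sub`). Direction: every client is selected with probability `B / n`, so
sampling is unbiased, and `E v` differs from `-η H ∇F(w)` only through the drift of the local models
and the error of the personalized ones (`inner_integral_round_sub_le`).

The heart is `secondMomentLE_clientState_snd_sub`. The error of the personalized model is measured
from the noiseless personalized model at the start of the round, a target that does not move. With
`s = m (η H)²` bounding the drift, the mean squared error stays below `α²σG²/K₀ + β α²σG² + (1 + α
L)² s` through all local iterations. The restart removes all memory of earlier rounds, so a client
that was idle for long carries no stale model.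

Telescoping the expected decrease bounds the average of `E‖∇F(w_r)‖²` by `2Δ/(η H R) + O((η H)²) +
O(1/K₀ + β) + O(η H)`. With `η H` and `β` of order `ε²`, `K₀ = H` of order `ε⁻²` and `R` of order
`ε⁻⁴`, all terms are `O(ε²)`; `exists_parameters` fixes the constants. The batch size `K` and the
number `B` of clients never have to grow. -/

/-- `X` is square integrable, with second moment at most `c`. -/
structure SecondMomentLE (X : Ω → E) (c : ℝ) (P : Measure Ω) : Prop where
  memLp : MemLp X 2 P
  le : ∫ ω, ‖X ω‖ ^ 2 ∂P ≤ c

namespace SecondMomentLE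

variable {X Y : Ω → E} {a b c : ℝ}

lemma of_sq_le {g : Ω → ℝ} (hX : AEStronglyMeasurable X P) (hg : Integrable g P)
    (h : ∀ᵐ ω ∂P, ‖X ω‖ ^ 2 ≤ g ω) (hc : ∫ ω, g ω ∂P ≤ c) : SecondMomentLE X c P := by
  have hi : Integrable (fun ω => ‖X ω‖ ^ 2) P :=
    hg.mono' (hX.norm.pow 2) (by simpa using h)
  exact ⟨(memLp_two_iff_integrable_sq_norm hX).2 hi, (integral_mono_ae hi hg h).trans hc⟩

lemma integrable_sq (h : SecondMomentLE X c P) : Integrable (fun ω => ‖X ω‖ ^ 2) P :=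
  (memLp_two_iff_integrable_sq_norm h.memLp.1).1 h.memLp

lemma nonneg (h : SecondMomentLE X c P) : 0 ≤ c :=
  (integral_nonneg fun _ => by positivity).trans h.le

lemma mono (h : SecondMomentLE X a P) (hab : a ≤ b) : SecondMomentLE X b P :=
  ⟨h.memLp, h.le.trans hab⟩

lemma integrable [IsFiniteMeasure P] (h : SecondMomentLE X c P) : Integrable X P :=
  h.memLp.integrable one_le_two

lemma mono_norm {F : Type*} [NormedAddCommGroup F] {Y : Ω → F} {k : ℝ}
    (h : SecondMomentLE X c P) (hY : AEStronglyMeasurable Y P)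
    (hk : ∀ ω, ‖Y ω‖ ≤ k * ‖X ω‖) : SecondMomentLE Y (k ^ 2 * c) P := by
  refine of_sq_le hY (h.integrable_sq.const_mul (k ^ 2)) (.of_forall fun ω => ?_) ?_
  · rw [← mul_pow]
    exact pow_le_pow_left₀ (norm_nonneg _) (hk ω) 2
  · rw [integral_const_mul]
    exact mul_le_mul_of_nonneg_left h.le (sq_nonneg k)

lemma const_smul [NormedSpace ℝ E] (h : SecondMomentLE X c P) (k : ℝ) :
    SecondMomentLE (fun ω => k • X ω) (k ^ 2 * c) P := by
  have := h.mono_norm (Y := fun ω => k • X ω) (k := |k|) (h.memLp.1.const_smul k)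
    (fun ω => by rw [norm_smul, Real.norm_eq_abs])
  rwa [sq_abs] at this

lemma norm_fun (h : SecondMomentLE X c P) : SecondMomentLE (fun ω => ‖X ω‖) c P :=
  ⟨h.memLp.norm, by simpa using h.le⟩

lemma add (hX : SecondMomentLE X a P) (hY : SecondMomentLE Y b P) :
    SecondMomentLE (fun ω => X ω + Y ω) (2 * a + 2 * b) P := by
  refine of_sq_le (hX.memLp.1.add hY.memLp.1)
    ((hX.integrable_sq.const_mul 2).add (hY.integrable_sq.const_mul 2)) (.of_forall fun ω => ?_) ?_
  · have h1 := pow_le_pow_left₀ (norm_nonneg _) (norm_add_le (X ω) (Y ω)) 2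
    simp only [Pi.add_apply]
    nlinarith [sq_nonneg (‖X ω‖ - ‖Y ω‖)]
  · simp only [Pi.add_apply]
    rw [integral_add (hX.integrable_sq.const_mul 2) (hY.integrable_sq.const_mul 2),
      integral_const_mul, integral_const_mul]
    linarith [hX.le, hY.le]

/-- Convexity of the squared norm. Unlike `add` it loses no factor 2, so it can be iterated over the
momentum steps without growth. -/
lemma convexComb [NormedSpace ℝ E] (hX : SecondMomentLE X a P) (hY : SecondMomentLE Y b P) {t : ℝ}
    (ht0 : 0 ≤ t) (ht1 : t ≤ 1) :
    SecondMomentLE (fun ω => (1 - t) • X ω + t • Y ω) ((1 - t) * a + t * b) P := by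
  refine of_sq_le ((hX.memLp.1.const_smul _).add (hY.memLp.1.const_smul _))
    ((hX.integrable_sq.const_mul (1 - t)).add (hY.integrable_sq.const_mul t))
    (.of_forall fun ω => ?_) ?_
  · have h1 : ‖(1 - t) • X ω + t • Y ω‖ ≤ (1 - t) * ‖X ω‖ + t * ‖Y ω‖ := by
      refine (norm_add_le _ _).trans_eq ?_
      rw [norm_smul, norm_smul, Real.norm_of_nonneg ht0, Real.norm_of_nonneg (sub_nonneg.2 ht1)]
    have h2 := pow_le_pow_left₀ (norm_nonneg _) h1 2
    simp only [Pi.add_apply]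
    nlinarith [mul_nonneg (mul_nonneg ht0 (sub_nonneg.2 ht1)) (sq_nonneg (‖X ω‖ - ‖Y ω‖))]
  · simp only [Pi.add_apply]
    rw [integral_add (hX.integrable_sq.const_mul _) (hY.integrable_sq.const_mul _),
      integral_const_mul, integral_const_mul]
    exact add_le_add (mul_le_mul_of_nonneg_left hX.le (sub_nonneg.2 ht1))
      (mul_le_mul_of_nonneg_left hY.le ht0)

/-- Cauchy–Schwarz; no independence is needed, at the price of the squared cardinality. -/
lemma finset_sum {ι : Type*} {s : Finset ι} {X : ι → Ω → E}
    (h : ∀ j ∈ s, SecondMomentLE (X j) c P) :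
    SecondMomentLE (fun ω => ∑ j ∈ s, X j ω) ((s.card : ℝ) ^ 2 * c) P := by
  have hi : ∀ j ∈ s, Integrable (fun ω => ‖X j ω‖ ^ 2) P := fun j hj => (h j hj).integrable_sq
  refine of_sq_le (Finset.aestronglyMeasurable_fun_sum s fun j hj => (h j hj).memLp.1)
    ((integrable_finsetSum s hi).const_mul (s.card : ℝ)) (.of_forall fun ω => ?_) ?_
  · exact (pow_le_pow_left₀ (norm_nonneg _) (norm_sum_le _ _) 2).trans sq_sum_le_card_mul_sum_sq
  · rw [integral_const_mul, integral_finsetSum s hi, pow_two, mul_assoc]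
    refine mul_le_mul_of_nonneg_left ?_ (Nat.cast_nonneg _)
    exact (Finset.sum_le_sum fun j hj => (h j hj).le).trans_eq (by simp)

lemma average [NormedSpace ℝ E] {K : ℕ} (hK : 1 ≤ K) {X : Fin K → Ω → E}
    (h : ∀ j, SecondMomentLE (X j) c P) :
    SecondMomentLE (fun ω => (K : ℝ)⁻¹ • ∑ j, X j ω) c P := by
  have hK' : (K : ℝ) ≠ 0 := by positivity
  refine ((finset_sum (s := Finset.univ) fun j _ => h j).const_smul ((K : ℝ)⁻¹)).mono (le_of_eq ?_)
  rw [Finset.card_univ, Fintype.card_fin]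
  field_simp

lemma const [IsProbabilityMeasure P] (x : E) : SecondMomentLE (fun _ : Ω => x) (‖x‖ ^ 2) P :=
  ⟨memLp_const x, by simp⟩

/-- Jensen's inequality, obtained from the nonnegativity of the variance of `‖X‖`. -/
lemma norm_integral_sq_le [NormedSpace ℝ E] [IsProbabilityMeasure P]
    (h : SecondMomentLE X c P) : ‖∫ ω, X ω ∂P‖ ^ 2 ≤ c := by
  set m := ∫ ω, ‖X ω‖ ∂P
  have hi := h.integrable.norm
  have h2 : 0 ≤ ∫ ω, (‖X ω‖ - m) ^ 2 ∂P := integral_nonneg fun _ => sq_nonneg _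
  have h3 : ∫ ω, (‖X ω‖ - m) ^ 2 ∂P = ∫ ω, ‖X ω‖ ^ 2 ∂P - m ^ 2 := by
    have : ∀ ω, (‖X ω‖ - m) ^ 2 = ‖X ω‖ ^ 2 - (2 * m) * ‖X ω‖ + m ^ 2 := fun ω => by ring
    simp_rw [this]
    rw [integral_add (f := fun ω => ‖X ω‖ ^ 2 - 2 * m * ‖X ω‖)
      (h.integrable_sq.sub (hi.const_mul _)) (integrable_const _), integral_sub h.integrable_sq (hi.const_mul _), integral_const_mul]
    simp only [integral_const, probReal_univ, smul_eq_mul, one_mul]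
    change _ - 2 * m * m + _ = _
    ring
  have h1 := pow_le_pow_left₀ (norm_nonneg _) (norm_integral_le_integral_norm (μ := P) X) 2
  linarith [h.le]

lemma integrable_inner [InnerProductSpace ℝ E] (hX : SecondMomentLE X a P)
    (hY : SecondMomentLE Y b P) : Integrable (fun ω => inner ℝ (X ω) (Y ω)) P := by
  refine (hX.integrable_sq.add hY.integrable_sq).mono' (hX.memLp.1.inner hY.memLp.1)
    (.of_forall fun ω => ?_)
  have := norm_inner_le_norm (𝕜 := ℝ) (X ω) (Y ω)
  simp only [Pi.add_apply]
  nlinarith [sq_nonneg (‖X ω‖ - ‖Y ω‖), sq_nonneg (‖X ω‖), sq_nonneg (‖Y ω‖)]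

lemma add_of_orthogonal [InnerProductSpace ℝ E] (hX : SecondMomentLE X a P)
    (hY : SecondMomentLE Y b P) (h : ∫ ω, inner ℝ (X ω) (Y ω) ∂P = 0) :
    SecondMomentLE (fun ω => X ω + Y ω) (a + b) P := by
  refine ⟨hX.memLp.add hY.memLp, ?_⟩
  simp_rw [norm_add_sq_real]
  have hi := (hX.integrable_inner hY).const_mul 2
  rw [integral_add (f := fun ω => ‖X ω‖ ^ 2 + 2 * inner ℝ (X ω) (Y ω))
    (hX.integrable_sq.add hi) hY.integrable_sq, integral_add hX.integrable_sq hi,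
    integral_const_mul, h]
  linarith [hX.le, hY.le]

end SecondMomentLE

end SecondMoment

/-! ### Independence and integration with one argument frozen. -/

section Independence

section SigmaAlgebra

variable {Ω : Type*}

/-- The σ-algebra generated by the members of the family `X` with index in `S`. -/
@[reducible] def familySigma {ι A : Type*} [mA : MeasurableSpace A] (X : ι → Ω → A) (S : Set ι) :
    MeasurableSpace Ω :=
  ⨆ i ∈ S, mA.comap (X i)

lemma measurable_familySigma {ι A : Type*} [mA : MeasurableSpace A] (X : ι → Ω → A) {S : Set ι}
    {i : ι} (hi : i ∈ S) : Measurable[familySigma X S] (X i) :=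
  measurable_iff_comap_le.2 (le_iSup₂ (f := fun i (_ : i ∈ S) => mA.comap (X i)) i hi)

end SigmaAlgebra

variable {Ω : Type*} [mΩ : MeasurableSpace Ω] {P : Measure Ω}

/-- Reduces every independence claim about the algorithm to bookkeeping: it is enough to know which
inputs each quantity reads. -/
lemma indepFun_of_familySigma {ι A U V : Type*} [MeasurableSpace A] [mU : MeasurableSpace U]
    [mV : MeasurableSpace V] {X : ι → Ω → A} (hX : ∀ i, Measurable (X i)) (hI : iIndepFun X P)
    {S T : Set ι} (hST : Disjoint S T) {u : Ω → U} {v : Ω → V}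
    (hu : Measurable[familySigma X S] u) (hv : Measurable[familySigma X T] v) :
    IndepFun u v P := by
  have h := indep_iSup_of_disjoint (fun i => (hX i).comap_le) hI.iIndep hST
  exact (IndepFun_iff_Indep _ _ _).2
    (indep_of_indep_of_le_right (indep_of_indep_of_le_left h hu.comap_le) hv.comap_le)

variable {U V E : Type*} [MeasurableSpace U] [MeasurableSpace V] [NormedAddCommGroup E]
  {u : Ω → U} {v : Ω → V} [IsProbabilityMeasure P]

/-- Fubini for the joint law, which is a product by independence. It plays the role of conditional
expectation: `u` is the past, `v` the fresh data, and the inner integral freezes the past. -/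
lemma integral_comp_indep [NormedSpace ℝ E] (hu : Measurable u) (hv : Measurable v)
    (h : IndepFun u v P) {φ : U → V → E} (hφ : StronglyMeasurable (Function.uncurry φ))
    (hi : Integrable (fun ω => φ (u ω) (v ω)) P) :
    ∫ ω, φ (u ω) (v ω) ∂P = ∫ ω, ∫ ω', φ (u ω) (v ω') ∂P ∂P := by
  have hm := (indepFun_iff_map_prod_eq_prod_map_map hu.aemeasurable hv.aemeasurable).1 h
  have := Measure.isProbabilityMeasure_map (μ := P) hu.aemeasurable
  have := Measure.isProbabilityMeasure_map (μ := P) hv.aemeasurable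
  have huv : AEMeasurable (fun ω => (u ω, v ω)) P := (hu.prodMk hv).aemeasurable
  have hi' : Integrable (Function.uncurry φ) ((P.map u).prod (P.map v)) := by
    rw [← hm]
    exact (integrable_map_measure hφ.aestronglyMeasurable huv).2 hi
  calc ∫ ω, φ (u ω) (v ω) ∂P
      = ∫ p, Function.uncurry φ p ∂(P.map fun ω => (u ω, v ω)) :=
        (integral_map huv hφ.aestronglyMeasurable).symm
    _ = ∫ a, ∫ b, φ a b ∂(P.map v) ∂(P.map u) := by
        rw [hm]
        exact integral_prod _ hi'
    _ = ∫ a, ∫ ω', φ a (v ω') ∂P ∂(P.map u) := by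
        refine integral_congr_ae (.of_forall fun a => ?_)
        exact integral_map hv.aemeasurable
          (hφ.comp_measurable measurable_prodMk_left).aestronglyMeasurable
    _ = _ := by
        refine integral_map hu.aemeasurable (StronglyMeasurable.aestronglyMeasurable ?_)
        refine StronglyMeasurable.integral_prod_right (f := fun a ω' => φ a (v ω')) ?_
        exact hφ.comp_measurable (measurable_fst.prodMk (hv.comp measurable_snd))

/-- A bound that is uniform in the frozen past survives averaging over it. Square integrability is
part of the conclusion and comes from Tonelli's criterion for the product law. -/
lemma SecondMomentLE.comp_indep (hu : Measurable u) (hv : Measurable v)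
    (h : IndepFun u v P) {φ : U → V → E} (hφ : StronglyMeasurable (Function.uncurry φ)) {c : ℝ}
    (hc : ∀ a, SecondMomentLE (fun ω => φ a (v ω)) c P) :
    SecondMomentLE (fun ω => φ (u ω) (v ω)) c P := by
  have hm := (indepFun_iff_map_prod_eq_prod_map_map hu.aemeasurable hv.aemeasurable).1 h
  have := Measure.isProbabilityMeasure_map (μ := P) hu.aemeasurable
  have := Measure.isProbabilityMeasure_map (μ := P) hv.aemeasurable
  have huv : AEMeasurable (fun ω => (u ω, v ω)) P := (hu.prodMk hv).aemeasurable
  have hmeas : AEStronglyMeasurable (fun ω => φ (u ω) (v ω)) P :=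
    (hφ.comp_measurable (hu.prodMk hv)).aestronglyMeasurable
  have hsq : StronglyMeasurable fun p : U × V => ‖Function.uncurry φ p‖ ^ 2 := hφ.norm.pow 2
  have hint : ∀ a, ∫ b, ‖φ a b‖ ^ 2 ∂(P.map v) ≤ c := fun a => by
    rw [integral_map (f := fun b => ‖φ a b‖ ^ 2) hv.aemeasurable
      (hsq.comp_measurable measurable_prodMk_left).aestronglyMeasurable]
    exact (hc a).le
  have hc0 : 0 ≤ c := by
    obtain ⟨ω⟩ : Nonempty Ω := nonempty_of_isProbabilityMeasure P
    exact (hc (u ω)).nonneg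
  have hi' : Integrable (fun p : U × V => ‖Function.uncurry φ p‖ ^ 2)
      ((P.map u).prod (P.map v)) := by
    refine (integrable_prod_iff hsq.aestronglyMeasurable).2 ⟨.of_forall fun a => ?_, ?_⟩
    · exact (integrable_map_measure
        (hsq.comp_measurable measurable_prodMk_left).aestronglyMeasurable hv.aemeasurable).2
        (hc a).integrable_sq
    · refine Integrable.of_bound (C := c)
        (hsq.norm.integral_prod_right (f := fun a b => ‖‖φ a b‖ ^ 2‖)).aestronglyMeasurable
        (.of_forall fun a => ?_)
      simp only [norm_pow, norm_norm, Function.uncurry]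
      rw [Real.norm_of_nonneg (integral_nonneg fun _ => by positivity)]
      exact hint a
  have hi : Integrable (fun ω => ‖φ (u ω) (v ω)‖ ^ 2) P := by
    rw [← hm] at hi'
    exact (integrable_map_measure hsq.aestronglyMeasurable huv).1 hi'
  refine ⟨(memLp_two_iff_integrable_sq_norm hmeas).2 hi, ?_⟩
  rw [integral_comp_indep hu hv h (φ := fun a b => ‖φ a b‖ ^ 2) hsq hi]
  calc _ ≤ ∫ _, c ∂P := integral_mono_of_nonneg (.of_forall fun _ => integral_nonneg fun _ =>
        by positivity) (integrable_const c) (.of_forall fun ω => (hc (u ω)).le)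
    _ = c := by simp

end Independence

/-! ### Smoothness of the meta-objective. -/

section Deterministic

variable {d : ℕ}

/-- The chain rule yields the adjoint of `I - α ∇²L_i(w)`, while the algorithm applies the operator
itself; symmetry of second derivatives identifies the two. -/
lemma hess_symm {f : Vec d → ℝ} (hf : Differentiable ℝ f)
    (hf' : Differentiable ℝ (gradient f)) (w x y : Vec d) :
    inner ℝ (hess f w x) y = inner ℝ x (hess f w y) := by
  have h1 : ∀ y, HasFDerivAt f (InnerProductSpace.toDual ℝ (Vec d) (gradient f y)) y :=
    fun y => (hf y).hasGradientAt
  have h2 : HasFDerivAt (fun y => InnerProductSpace.toDual ℝ (Vec d) (gradient f y))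
      ((innerSL ℝ).comp (hess f w)) w :=
    (innerSL ℝ).hasFDerivAt.comp w (hf' w).hasFDerivAt
  have h3 := second_derivative_symmetric h1 h2 x y
  simp only [ContinuousLinearMap.comp_apply, innerSL_apply_apply] at h3
  rw [h3, real_inner_comm]

lemma norm_hess_le_of_lipschitz {f : Vec d → ℝ} {L : ℝ} (hL : 0 ≤ L)
    (h : ∀ w w', ‖gradient f w - gradient f w'‖ ≤ L * ‖w - w'‖) (w : Vec d) :
    ‖hess f w‖ ≤ L :=
  norm_fderiv_le_of_lip' ℝ hL (.of_forall fun x => h x w)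

/-- The quadratic upper bound for a function with Lipschitz gradient. -/
lemma le_add_inner_add_sq {F : Vec d → ℝ} {g : Vec d → Vec d} {M : ℝ} (hM : 0 ≤ M)
    (hF : ∀ w, HasGradientAt F (g w) w) (hg : ∀ w w', ‖g w - g w'‖ ≤ M * ‖w - w'‖)
    (w v : Vec d) : F (w + v) ≤ F w + inner ℝ (g w) v + M * ‖v‖ ^ 2 := by
  -- Without its linear part at `w`, `F` has derivative at most `M * ‖v‖` on the ball of radius
  -- `‖v‖`. The mean value inequality then gives the constant `M` rather than `M / 2`, which is
  -- harmless here.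
  set φ : Vec d → ℝ := fun y => F y - inner ℝ (g w) y
  have hφ : ∀ y, HasFDerivAt φ
      (InnerProductSpace.toDual ℝ (Vec d) (g y) - innerSL ℝ (g w)) y :=
    fun y => (hF y).sub ((innerSL ℝ (g w)).hasFDerivAt)
  have hw : w ∈ Metric.closedBall w ‖v‖ := Metric.mem_closedBall_self (norm_nonneg v)
  have hv : w + v ∈ Metric.closedBall w ‖v‖ := by simp
  have h := (convex_closedBall w ‖v‖).norm_image_sub_le_of_norm_hasFDerivWithin_le
    (C := M * ‖v‖) (fun y _ => (hφ y).hasFDerivWithinAt) (fun y hy => by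
      have : InnerProductSpace.toDual ℝ (Vec d) (g y) - innerSL ℝ (g w)
          = InnerProductSpace.toDual ℝ (Vec d) (g y - g w) := by
        ext x; simp
      rw [this, LinearIsometryEquiv.norm_map]
      exact (hg y w).trans (mul_le_mul_of_nonneg_left
        (by simpa [dist_eq_norm] using hy) hM)) hw hv
  have h2 := (le_abs_self _).trans h
  simp only [φ, add_sub_cancel_left, inner_add_right] at h2
  nlinarith

variable {Z : Type*} [MeasurableSpace Z] {n : ℕ} {D : Fin n → Measure Z}
  {ℓ : Fin n → Vec d → Z → ℝ} {α L ρ σG σH G : ℝ}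

/-- The conditional mean of the stochastic meta-gradient of task `i` at meta model `w` and
personalized model `u`. -/
noncomputable def meanMetaGrad (D : Fin n → Measure Z) (ℓ : Fin n → Vec d → Z → ℝ) (α : ℝ)
    (i : Fin n) (w u : Vec d) : Vec d :=
  (ContinuousLinearMap.id ℝ (Vec d) - α • hess (risk D ℓ i) w) (gradient (risk D ℓ i) u)

/-- The personalized model of task `i` at meta model `w` in the absence of noise. -/
noncomputable def idealPersonal (D : Fin n → Measure Z) (ℓ : Fin n → Vec d → Z → ℝ) (α : ℝ)
    (i : Fin n) (w : Vec d) : Vec d :=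
  w - α • gradient (risk D ℓ i) w

namespace Assumptions

lemma norm_hess_le (hA : Assumptions D ℓ α L ρ σG σH G) (hL : 0 ≤ L) (i : Fin n) (w : Vec d) :
    ‖hess (risk D ℓ i) w‖ ≤ L :=
  norm_hess_le_of_lipschitz hL (hA.grad_lipschitz i) w

lemma norm_id_sub_hess_le (hA : Assumptions D ℓ α L ρ σG σH G) (hα : 0 ≤ α) (hL : 0 ≤ L)
    (i : Fin n) (w : Vec d) :
    ‖ContinuousLinearMap.id ℝ (Vec d) - α • hess (risk D ℓ i) w‖ ≤ 1 + α * L := by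
  refine (norm_sub_le _ _).trans (add_le_add ContinuousLinearMap.norm_id_le ?_)
  rw [norm_smul, Real.norm_of_nonneg hα]
  exact mul_le_mul_of_nonneg_left (hA.norm_hess_le hL i w) hα

lemma norm_idealPersonal_sub_le (hA : Assumptions D ℓ α L ρ σG σH G) (hα : 0 ≤ α)
    (i : Fin n) (w w' : Vec d) :
    ‖idealPersonal D ℓ α i w - idealPersonal D ℓ α i w'‖ ≤ (1 + α * L) * ‖w - w'‖ := by
  have h : idealPersonal D ℓ α i w - idealPersonal D ℓ α i w'
      = (w - w') - α • (gradient (risk D ℓ i) w - gradient (risk D ℓ i) w') := by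
    simp only [idealPersonal, smul_sub]; abel
  rw [h]
  refine (norm_sub_le _ _).trans ?_
  rw [norm_smul, Real.norm_of_nonneg hα]
  have := mul_le_mul_of_nonneg_left (hA.grad_lipschitz i w w') hα
  linarith

/-- Add and subtract the mixed term: the change of the Hessian acts on a gradient bounded by `G`,
and the change of the gradient is acted on by an operator of norm at most `1 + α * L`. -/
lemma norm_meanMetaGrad_sub_le (hA : Assumptions D ℓ α L ρ σG σH G) (hα : 0 ≤ α) (hL : 0 ≤ L)
    (i : Fin n) (w w' u u' : Vec d) :
    ‖meanMetaGrad D ℓ α i w u - meanMetaGrad D ℓ α i w' u'‖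
      ≤ α * ρ * G * ‖w - w'‖ + (1 + α * L) * L * ‖u - u'‖ := by
  have h : meanMetaGrad D ℓ α i w u - meanMetaGrad D ℓ α i w' u'
      = (-α) • ((hess (risk D ℓ i) w - hess (risk D ℓ i) w') (gradient (risk D ℓ i) u))
        + (ContinuousLinearMap.id ℝ (Vec d) - α • hess (risk D ℓ i) w')
          (gradient (risk D ℓ i) u - gradient (risk D ℓ i) u') := by
    simp only [meanMetaGrad, map_sub, sub_apply,
      smul_apply, ContinuousLinearMap.id_apply, smul_sub, neg_smul]
    abel
  rw [h]
  refine (norm_add_le _ _).trans (add_le_add ?_ ?_)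
  · rw [norm_smul, norm_neg, Real.norm_of_nonneg hα]
    have h1 := ContinuousLinearMap.le_of_opNorm_le_of_le _ (hA.hess_lipschitz i w w')
      (hA.grad_bounded i u)
    calc _ ≤ α * (ρ * ‖w - w'‖ * G) := mul_le_mul_of_nonneg_left h1 hα
      _ = _ := by ring
  · have h1 := ContinuousLinearMap.le_of_opNorm_le_of_le _ (hA.norm_id_sub_hess_le hα hL i w')
      (hA.grad_lipschitz i u u')
    linarith

lemma norm_meanMetaGrad_le (hA : Assumptions D ℓ α L ρ σG σH G) (hα : 0 ≤ α) (hL : 0 ≤ L)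
    (i : Fin n) (w u : Vec d) : ‖meanMetaGrad D ℓ α i w u‖ ≤ (1 + α * L) * G :=
  ContinuousLinearMap.le_of_opNorm_le_of_le _ (hA.norm_id_sub_hess_le hα hL i w)
    (hA.grad_bounded i u)

lemma hasGradientAt_risk_idealPersonal (hA : Assumptions D ℓ α L ρ σG σH G) (i : Fin n)
    (w : Vec d) :
    HasGradientAt (fun w => risk D ℓ i (idealPersonal D ℓ α i w))
      (meanMetaGrad D ℓ α i w (idealPersonal D ℓ α i w)) w := by
  have h1 : HasFDerivAt (idealPersonal D ℓ α i)
      (ContinuousLinearMap.id ℝ (Vec d) - α • hess (risk D ℓ i) w) w :=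
    (hasFDerivAt_id w).sub (((hA.differentiable_grad_risk i w).hasFDerivAt).const_smul α)
  have h2 := ((hA.differentiable_risk i (idealPersonal D ℓ α i w)).hasGradientAt).hasFDerivAt
  have h3 := h2.comp w h1
  rw [hasGradientAt_iff_hasFDerivAt]
  refine h3.congr_fderiv ?_
  ext x
  simp only [ContinuousLinearMap.comp_apply, InnerProductSpace.toDual_apply_apply, meanMetaGrad,
    sub_apply, smul_apply, ContinuousLinearMap.id_apply,
    inner_sub_left, inner_sub_right, inner_smul_left, inner_smul_right,
    hess_symm (hA.differentiable_risk i) (hA.differentiable_grad_risk i)]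
  simp

lemma hasGradientAt_metaObjective (hA : Assumptions D ℓ α L ρ σG σH G) (w : Vec d) :
    HasGradientAt (metaObjective D ℓ α)
      ((n : ℝ)⁻¹ • ∑ i, meanMetaGrad D ℓ α i w (idealPersonal D ℓ α i w)) w := by
  rw [hasGradientAt_iff_hasFDerivAt, map_smul, map_sum]
  exact (HasFDerivAt.fun_sum fun i _ =>
    (hA.hasGradientAt_risk_idealPersonal i w).hasFDerivAt).const_mul _

lemma gradient_metaObjective (hA : Assumptions D ℓ α L ρ σG σH G) (w : Vec d) :
    gradient (metaObjective D ℓ α) w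
      = (n : ℝ)⁻¹ • ∑ i, meanMetaGrad D ℓ α i w (idealPersonal D ℓ α i w) :=
  (hA.hasGradientAt_metaObjective w).gradient

lemma norm_average_le {c : ℝ} (hc : 0 ≤ c) {x : Fin n → Vec d} (h : ∀ i, ‖x i‖ ≤ c) :
    ‖(n : ℝ)⁻¹ • ∑ i, x i‖ ≤ c := by
  rw [norm_smul, norm_inv, Real.norm_natCast]
  have h1 : ‖∑ i, x i‖ ≤ n * c :=
    (norm_sum_le _ _).trans ((Finset.sum_le_sum fun i _ => h i).trans_eq (by simp))
  rcases Nat.eq_zero_or_pos n with rfl | hn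
  · simpa using hc
  · rw [inv_mul_le_iff₀ (by positivity)]
    exact h1

lemma norm_gradient_metaObjective_le (hA : Assumptions D ℓ α L ρ σG σH G) (hα : 0 ≤ α)
    (hL : 0 ≤ L) (hG : 0 ≤ G) (w : Vec d) :
    ‖gradient (metaObjective D ℓ α) w‖ ≤ (1 + α * L) * G := by
  rw [hA.gradient_metaObjective]
  exact norm_average_le (by positivity) fun i => hA.norm_meanMetaGrad_le hα hL i _ _

lemma norm_gradient_metaObjective_sub_le (hA : Assumptions D ℓ α L ρ σG σH G) (hα : 0 ≤ α)
    (hL : 0 ≤ L) (hρ : 0 ≤ ρ) (hG : 0 ≤ G) (w w' : Vec d) :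
    ‖gradient (metaObjective D ℓ α) w - gradient (metaObjective D ℓ α) w'‖
      ≤ (α * ρ * G + (1 + α * L) ^ 2 * L) * ‖w - w'‖ := by
  rw [hA.gradient_metaObjective, hA.gradient_metaObjective, ← smul_sub, ← Finset.sum_sub_distrib]
  refine norm_average_le (by positivity) fun i => ?_
  refine (hA.norm_meanMetaGrad_sub_le hα hL i _ _ _ _).trans ?_
  have := mul_le_mul_of_nonneg_left (hA.norm_idealPersonal_sub_le hα i w w')
    (by positivity : 0 ≤ (1 + α * L) * L)
  nlinarith

lemma metaObjective_add_le (hA : Assumptions D ℓ α L ρ σG σH G) (hα : 0 ≤ α)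
    (hL : 0 ≤ L) (hρ : 0 ≤ ρ) (hG : 0 ≤ G) (w v : Vec d) :
    metaObjective D ℓ α (w + v) ≤ metaObjective D ℓ α w
      + inner ℝ (gradient (metaObjective D ℓ α) w) v
      + (α * ρ * G + (1 + α * L) ^ 2 * L) * ‖v‖ ^ 2 :=
  le_add_inner_add_sq (by positivity)
    (fun w => (hA.hasGradientAt_metaObjective w).differentiableAt.hasGradientAt)
    (hA.norm_gradient_metaObjective_sub_le hα hL hρ hG) w v

lemma continuous_metaObjective (hA : Assumptions D ℓ α L ρ σG σH G) :
    Continuous (metaObjective D ℓ α) :=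
  continuous_iff_continuousAt.2 fun w =>
    (hA.hasGradientAt_metaObjective w).differentiableAt.continuousAt

/-- The gradient of `F` is bounded. This makes `F` integrable along the iterates as soon as their
displacements are integrable. -/
lemma abs_metaObjective_sub_le (hA : Assumptions D ℓ α L ρ σG σH G) (hα : 0 ≤ α)
    (hL : 0 ≤ L) (hG : 0 ≤ G) (w w' : Vec d) :
    |metaObjective D ℓ α w' - metaObjective D ℓ α w| ≤ (1 + α * L) * G * ‖w' - w‖ := by
  refine convex_univ.norm_image_sub_le_of_norm_hasFDerivWithin_le
    (f' := fun w => InnerProductSpace.toDual ℝ (Vec d) (gradient (metaObjective D ℓ α) w))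
    (fun x _ => ?_) (fun x _ => ?_) (Set.mem_univ w) (Set.mem_univ w')
  · exact (hA.hasGradientAt_metaObjective x).differentiableAt.hasGradientAt.hasFDerivAt
      |>.hasFDerivWithinAt
  · rw [LinearIsometryEquiv.norm_map]
    exact hA.norm_gradient_metaObjective_le hα hL hG x

lemma continuous_gradient_metaObjective (hA : Assumptions D ℓ α L ρ σG σH G) (hα : 0 ≤ α)
    (hL : 0 ≤ L) (hρ : 0 ≤ ρ) (hG : 0 ≤ G) : Continuous (gradient (metaObjective D ℓ α)) :=
  (LipschitzWith.of_dist_le_mul (K := (α * ρ * G + (1 + α * L) ^ 2 * L).toNNReal) fun w w' => by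
    rw [dist_eq_norm, dist_eq_norm, Real.coe_toNNReal _ (by positivity)]
    exact hA.norm_gradient_metaObjective_sub_le hα hL hρ hG w w').continuous

lemma continuous_gradient_risk (hA : Assumptions D ℓ α L ρ σG σH G) (i : Fin n) :
    Continuous (gradient (risk D ℓ i)) :=
  (hA.differentiable_grad_risk i).continuous

lemma continuous_hess_risk (hA : Assumptions D ℓ α L ρ σG σH G) (hρ : 0 ≤ ρ) (i : Fin n) :
    Continuous (hess (risk D ℓ i)) :=
  (LipschitzWith.of_dist_le_mul (K := ρ.toNNReal) fun w w' => by
    rw [dist_eq_norm, dist_eq_norm, Real.coe_toNNReal _ hρ]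
    exact hA.hess_lipschitz i w w').continuous

lemma continuous_meanMetaGrad (hA : Assumptions D ℓ α L ρ σG σH G) (hρ : 0 ≤ ρ) (i : Fin n) :
    Continuous fun p : Vec d × Vec d => meanMetaGrad D ℓ α i p.1 p.2 := by
  have h1 := hA.continuous_gradient_risk i
  have h2 := hA.continuous_hess_risk hρ i
  unfold meanMetaGrad
  fun_prop

end Assumptions

end Deterministic

/-! ### Mean and second moment of the mini-batch estimators. -/

section MiniBatch

lemma SecondMomentLE.comp_measurePreserving {Ω A E : Type*} [MeasurableSpace Ω]
    [MeasurableSpace A] {P : Measure Ω} {ν : Measure A} [NormedAddCommGroup E] {X : A → E} {c : ℝ}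
    (h : SecondMomentLE X c ν) {z : Ω → A} (hz : MeasurePreserving z P ν) :
    SecondMomentLE (fun ω => X (z ω)) c P := by
  refine ⟨h.memLp.comp_measurePreserving hz, ?_⟩
  rw [← integral_map (f := fun a => ‖X a‖ ^ 2) hz.measurable.aemeasurable, hz.map_eq]
  · exact h.le
  · rw [hz.map_eq]
    exact h.integrable_sq.1

lemma integral_comp_measurePreserving {Ω A E : Type*} [MeasurableSpace Ω]
    [MeasurableSpace A] {P : Measure Ω} {ν : Measure A} [NormedAddCommGroup E] [NormedSpace ℝ E]
    {X : A → E} {z : Ω → A} (hz : MeasurePreserving z P ν) (hX : AEStronglyMeasurable X ν) :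
    ∫ ω, X (z ω) ∂P = ∫ a, X a ∂ν := by
  rw [← integral_map hz.measurable.aemeasurable (by rwa [hz.map_eq]), hz.map_eq]

/-- Cross terms of centred, pairwise independent variables vanish, so the bound grows linearly in
the cardinality. This is the source of the gain `1 / K₀` at the restart. -/
lemma SecondMomentLE.finset_sum_of_indep {Ω ι E : Type*} [MeasurableSpace Ω]
    {P : Measure Ω} [IsProbabilityMeasure P] [NormedAddCommGroup E] [InnerProductSpace ℝ E]
    [CompleteSpace E] [MeasurableSpace E] [BorelSpace E] {X : ι → Ω → E} {c : ℝ}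
    (h : ∀ j, SecondMomentLE (X j) c P) (h0 : ∀ j, ∫ ω, X j ω ∂P = 0)
    (hI : Pairwise fun j k => IndepFun (X j) (X k) P) (s : Finset ι) :
    SecondMomentLE (fun ω => ∑ j ∈ s, X j ω) (s.card * c) P := by
  classical
  induction s using Finset.induction_on with
  | empty => simpa using SecondMomentLE.const (P := P) (0 : E)
  | insert a s ha ih =>
    simp_rw [Finset.sum_insert ha]
    refine ((h a).add_of_orthogonal ih ?_).mono (le_of_eq ?_)
    · simp_rw [inner_sum]
      rw [integral_finsetSum s fun j _ => (h a).integrable_inner (h j)]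
      refine Finset.sum_eq_zero fun j hj => ?_
      have := (hI (fun e => ha (e ▸ hj) : a ≠ j)).integral_bilin (h a).integrable
        (h j).integrable (innerSL ℝ)
      exact this.trans (by simp [h0])
    · rw [Finset.card_insert_of_notMem ha]
      push_cast
      ring

variable {d n : ℕ} {Z Ω : Type*} {K : ℕ}

lemma stochGrad_sub (f : Vec d → Z → ℝ) (hK : 1 ≤ K) (S : Fin K → Z) (w g : Vec d) :
    stochGrad f S w - g = (K : ℝ)⁻¹ • ∑ k, (gradient (fun x => f x (S k)) w - g) := by
  have hK' : (K : ℝ) ≠ 0 := by positivity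
  rw [Finset.sum_sub_distrib, smul_sub, Finset.sum_const, Finset.card_univ, Fintype.card_fin,
    ← Nat.cast_smul_eq_nsmul ℝ, inv_smul_smul₀ hK', stochGrad]

lemma stochHess_sub (f : Vec d → Z → ℝ) (hK : 1 ≤ K) (S : Fin K → Z) (w : Vec d)
    (g : Vec d →L[ℝ] Vec d) :
    stochHess f S w - g = (K : ℝ)⁻¹ • ∑ k, (hess (fun x => f x (S k)) w - g) := by
  have hK' : (K : ℝ) ≠ 0 := by positivity
  rw [Finset.sum_sub_distrib, smul_sub, Finset.sum_const, Finset.card_univ, Fintype.card_fin,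
    ← Nat.cast_smul_eq_nsmul ℝ, inv_smul_smul₀ hK', stochHess]

lemma _root_.Measurable.clm_apply_vec {A : Type*} [MeasurableSpace A] {T : A → Vec d →L[ℝ] Vec d}
    {v : A → Vec d} (hT : Measurable T) (hv : Measurable v) : Measurable fun a => T a (v a) :=
  (isBoundedBilinearMap_apply (𝕜 := ℝ) (E := Vec d) (F := Vec d)).continuous.measurable.comp
    (hT.prodMk hv)

variable [MeasurableSpace Z] [MeasurableSpace Ω] {D : Fin n → Measure Z}
  {ℓ : Fin n → Vec d → Z → ℝ} {α L ρ σG σH G : ℝ} {P : Measure Ω}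

namespace Assumptions

lemma measurable_stochGrad (hA : Assumptions D ℓ α L ρ σG σH G) (i : Fin n)
    {S : Ω → Fin K → Z} {w : Ω → Vec d} (hS : ∀ k, Measurable fun ω => S ω k)
    (hw : Measurable w) : Measurable fun ω => stochGrad (ℓ i) (S ω) (w ω) :=
  (Finset.measurable_fun_sum _ fun k _ =>
    (hA.measurable_grad i).comp (hw.prodMk (hS k))).const_smul (K : ℝ)⁻¹

lemma measurable_stochHess (hA : Assumptions D ℓ α L ρ σG σH G) (i : Fin n)
    {S : Ω → Fin K → Z} {w : Ω → Vec d} (hS : ∀ k, Measurable fun ω => S ω k)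
    (hw : Measurable w) : Measurable fun ω => stochHess (ℓ i) (S ω) (w ω) :=
  (Finset.measurable_fun_sum _ fun k _ =>
    (hA.measurable_hess i).comp (hw.prodMk (hS k))).const_smul (K : ℝ)⁻¹

lemma measurable_metaGrad (hA : Assumptions D ℓ α L ρ σG σH G) (i : Fin n) {a : ℝ}
    {S S' : Ω → Fin K → Z} {w u : Ω → Vec d} (hS : ∀ k, Measurable fun ω => S ω k)
    (hS' : ∀ k, Measurable fun ω => S' ω k) (hw : Measurable w) (hu : Measurable u) :
    Measurable fun ω => metaGrad (ℓ i) a (S ω) (S' ω) (w ω) (u ω) :=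
  Measurable.clm_apply_vec
    (measurable_const.sub ((hA.measurable_stochHess i hS hw).const_smul a))
    (hA.measurable_stochGrad i hS' hu)

lemma measurable_personalUpdate (hA : Assumptions D ℓ α L ρ σG σH G) (i : Fin n) {a b : ℝ}
    {S : Ω → Fin K → Z} {w u : Ω → Vec d} (hS : ∀ k, Measurable fun ω => S ω k)
    (hw : Measurable w) (hu : Measurable u) :
    Measurable fun ω => personalUpdate (ℓ i) a b (S ω) (w ω) (u ω) :=
  (hu.const_smul (1 - b)).add
    ((hw.sub ((hA.measurable_stochGrad i hS hw).const_smul a)).const_smul b)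

lemma secondMomentLE_grad (hA : Assumptions D ℓ α L ρ σG σH G) [∀ i, IsProbabilityMeasure (D i)]
    (i : Fin n) (w : Vec d) :
    SecondMomentLE (fun z => gradient (fun x => ℓ i x z) w - gradient (risk D ℓ i) w) (σG ^ 2)
      (D i) :=
  ⟨(memLp_two_iff_integrable_sq_norm
    ((hA.integrable_grad i w).sub (integrable_const _)).1).2 (hA.integrable_var_grad i w),
    hA.var_grad_le i w⟩

lemma secondMomentLE_hess (hA : Assumptions D ℓ α L ρ σG σH G) [∀ i, IsProbabilityMeasure (D i)]
    (i : Fin n) (w : Vec d) :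
    SecondMomentLE (fun z => hess (fun x => ℓ i x z) w - hess (risk D ℓ i) w) (σH ^ 2)
      (D i) :=
  ⟨(memLp_two_iff_integrable_sq_norm
    ((hA.integrable_hess i w).sub (integrable_const _)).1).2 (hA.integrable_var_hess i w),
    hA.var_hess_le i w⟩

lemma indepFun_id_sub_stochHess_stochGrad (hA : Assumptions D ℓ α L ρ σG σH G)
    {i : Fin n} {S S' : Ω → Fin K → Z}
    (hI : IndepFun S S' P) (w u : Vec d) :
    IndepFun (fun ω => ContinuousLinearMap.id ℝ (Vec d) - α • stochHess (ℓ i) (S ω) w)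
      (fun ω => stochGrad (ℓ i) (S' ω) u) P :=
  hI.comp
    (φ := fun s => ContinuousLinearMap.id ℝ (Vec d) - α • stochHess (ℓ i) s w)
    (ψ := fun s => stochGrad (ℓ i) s u)
    (measurable_const.sub ((hA.measurable_stochHess i measurable_pi_apply
      measurable_const).const_smul α))
    (hA.measurable_stochGrad i measurable_pi_apply measurable_const)

lemma integral_stochGrad (hA : Assumptions D ℓ α L ρ σG σH G) {i : Fin n}
    {S : Ω → Fin K → Z} (hK : 1 ≤ K)
    (hS : ∀ k, MeasurePreserving (fun ω => S ω k) P (D i)) (w : Vec d) :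
    ∫ ω, stochGrad (ℓ i) (S ω) w ∂P = gradient (risk D ℓ i) w := by
  have hK' : (K : ℝ) ≠ 0 := by positivity
  simp only [stochGrad]
  rw [integral_smul, integral_finsetSum (f := fun k ω => gradient (fun x => ℓ i x (S ω k)) w) _
    fun k _ => (hS k).integrable_comp_of_integrable (hA.integrable_grad i w)]
  simp_rw [fun k => integral_comp_measurePreserving (hS k) (hA.integrable_grad i w).1,
    hA.unbiased_grad]
  rw [Finset.sum_const, Finset.card_univ, Fintype.card_fin, ← Nat.cast_smul_eq_nsmul ℝ,
    inv_smul_smul₀ hK']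

lemma integral_stochHess (hA : Assumptions D ℓ α L ρ σG σH G) {i : Fin n}
    {S : Ω → Fin K → Z} (hK : 1 ≤ K)
    (hS : ∀ k, MeasurePreserving (fun ω => S ω k) P (D i)) (w : Vec d) :
    ∫ ω, stochHess (ℓ i) (S ω) w ∂P = hess (risk D ℓ i) w := by
  have hK' : (K : ℝ) ≠ 0 := by positivity
  simp only [stochHess]
  rw [integral_smul, integral_finsetSum (f := fun k ω => hess (fun x => ℓ i x (S ω k)) w) _
    fun k _ => (hS k).integrable_comp_of_integrable (hA.integrable_hess i w)]
  simp_rw [fun k => integral_comp_measurePreserving (hS k) (hA.integrable_hess i w).1,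
    hA.unbiased_hess]
  rw [Finset.sum_const, Finset.card_univ, Fintype.card_fin, ← Nat.cast_smul_eq_nsmul ℝ,
    inv_smul_smul₀ hK']

variable [∀ i, IsProbabilityMeasure (D i)] {S : Ω → Fin K → Z} {i : Fin n}

/-- Convexity alone: the gain `1 / K` is given up, since `K` is a fixed constant and `β` damps this
noise. -/
lemma secondMomentLE_stochGrad_sub (hA : Assumptions D ℓ α L ρ σG σH G) (hK : 1 ≤ K)
    (hS : ∀ k, MeasurePreserving (fun ω => S ω k) P (D i)) (w : Vec d) :
    SecondMomentLE (fun ω => stochGrad (ℓ i) (S ω) w - gradient (risk D ℓ i) w) (σG ^ 2) P := by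
  simp_rw [stochGrad_sub _ hK]
  exact .average hK fun k => (hA.secondMomentLE_grad i w).comp_measurePreserving (hS k)

lemma secondMomentLE_stochHess_sub (hA : Assumptions D ℓ α L ρ σG σH G) (hK : 1 ≤ K)
    (hS : ∀ k, MeasurePreserving (fun ω => S ω k) P (D i)) (w : Vec d) :
    SecondMomentLE (fun ω => stochHess (ℓ i) (S ω) w - hess (risk D ℓ i) w) (σH ^ 2) P := by
  simp_rw [stochHess_sub _ hK]
  exact .average hK fun k => (hA.secondMomentLE_hess i w).comp_measurePreserving (hS k)

lemma secondMomentLE_stochGrad_sub_of_indep [IsProbabilityMeasure P]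
    (hA : Assumptions D ℓ α L ρ σG σH G) (hK : 1 ≤ K)
    (hS : ∀ k, MeasurePreserving (fun ω => S ω k) P (D i))
    (hI : iIndepFun (fun k ω => S ω k) P) (w : Vec d) :
    SecondMomentLE (fun ω => stochGrad (ℓ i) (S ω) w - gradient (risk D ℓ i) w) (σG ^ 2 / K)
      P := by
  simp_rw [stochGrad_sub _ hK]
  have hK' : (K : ℝ) ≠ 0 := by positivity
  have hm : Measurable fun z => gradient (fun x => ℓ i x z) w - gradient (risk D ℓ i) w :=
    ((hA.measurable_grad i).comp measurable_prodMk_left).sub measurable_const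
  refine ((SecondMomentLE.finset_sum_of_indep (s := Finset.univ)
    (fun k => (hA.secondMomentLE_grad i w).comp_measurePreserving (hS k)) (fun k => ?_)
    fun j k hjk => (hI.indepFun hjk).comp hm hm).const_smul ((K : ℝ)⁻¹)).mono (le_of_eq ?_)
  · rw [integral_comp_measurePreserving (hS k) (hA.secondMomentLE_grad i w).memLp.1,
      integral_sub (hA.integrable_grad i w) (integrable_const _), hA.unbiased_grad]
    simp
  · rw [Finset.card_univ, Fintype.card_fin]
    field_simp

/-- A bound for the second moment of the stochastic meta-gradient. -/
noncomputable def _root_.LocalMOML.metaGradBound (α L σG σH G : ℝ) : ℝ :=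
  (2 * (1 + α * L) ^ 2 + 2 * (α ^ 2 * σH ^ 2)) * (2 * σG ^ 2 + 2 * G ^ 2)

variable [IsProbabilityMeasure P] {S' : Ω → Fin K → Z}

lemma secondMomentLE_stochGrad (hA : Assumptions D ℓ α L ρ σG σH G) (hK : 1 ≤ K)
    (hS : ∀ k, MeasurePreserving (fun ω => S ω k) P (D i)) (w : Vec d) :
    SecondMomentLE (fun ω => stochGrad (ℓ i) (S ω) w) (2 * σG ^ 2 + 2 * G ^ 2) P := by
  have h := (hA.secondMomentLE_stochGrad_sub hK hS w).add
    (SecondMomentLE.const (gradient (risk D ℓ i) w))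
  simp only [sub_add_cancel] at h
  exact h.mono (by gcongr; exact hA.grad_bounded i w)

lemma secondMomentLE_id_sub_stochHess (hA : Assumptions D ℓ α L ρ σG σH G) (hα : 0 ≤ α)
    (hL : 0 ≤ L) (hK : 1 ≤ K) (hS : ∀ k, MeasurePreserving (fun ω => S ω k) P (D i)) (w : Vec d) :
    SecondMomentLE (fun ω => ContinuousLinearMap.id ℝ (Vec d) - α • stochHess (ℓ i) (S ω) w)
      (2 * (1 + α * L) ^ 2 + 2 * (α ^ 2 * σH ^ 2)) P := by
  have h := (SecondMomentLE.const (ContinuousLinearMap.id ℝ (Vec d) - α • hess (risk D ℓ i) w)).add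
    ((hA.secondMomentLE_stochHess_sub hK hS w).const_smul (-α))
  have e : ∀ ω, ContinuousLinearMap.id ℝ (Vec d) - α • hess (risk D ℓ i) w
      + (-α) • (stochHess (ℓ i) (S ω) w - hess (risk D ℓ i) w)
      = ContinuousLinearMap.id ℝ (Vec d) - α • stochHess (ℓ i) (S ω) w := fun ω => by
    module
  simp_rw [e, neg_sq] at h
  exact h.mono (by gcongr; exact hA.norm_id_sub_hess_le hα hL i w)

/-- The Hessian and gradient batches are independent, so the second moment of the product is bounded
by a product of second moments; no fourth moments are required. -/
lemma secondMomentLE_metaGrad (hA : Assumptions D ℓ α L ρ σG σH G) (hα : 0 ≤ α) (hL : 0 ≤ L)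
    (hK : 1 ≤ K) (hS : ∀ k, MeasurePreserving (fun ω => S ω k) P (D i))
    (hS' : ∀ k, MeasurePreserving (fun ω => S' ω k) P (D i)) (hI : IndepFun S S' P)
    (w u : Vec d) :
    SecondMomentLE (fun ω => metaGrad (ℓ i) α (S ω) (S' ω) w u) (metaGradBound α L σG σH G) P := by
  have h1 := hA.secondMomentLE_id_sub_stochHess hα hL hK hS w
  have h2 := hA.secondMomentLE_stochGrad hK hS' u
  have hI' := (hA.indepFun_id_sub_stochHess_stochGrad (i := i) hI w u).comp
    (φ := fun T => ‖T‖ ^ 2) (ψ := fun v => ‖v‖ ^ 2) (by fun_prop) (by fun_prop)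
  refine .of_sq_le (g := fun ω =>
      ‖ContinuousLinearMap.id ℝ (Vec d) - α • stochHess (ℓ i) (S ω) w‖ ^ 2
        * ‖stochGrad (ℓ i) (S' ω) u‖ ^ 2)
    (hA.measurable_metaGrad i (fun k => (hS k).measurable) (fun k => (hS' k).measurable)
      measurable_const measurable_const).aestronglyMeasurable
    (hI'.integrable_mul h1.integrable_sq h2.integrable_sq) (.of_forall fun ω => ?_) ?_
  · rw [← mul_pow]
    exact pow_le_pow_left₀ (norm_nonneg _) (ContinuousLinearMap.le_opNorm _ _) 2
  · refine (hI'.integral_fun_mul_eq_mul_integral h1.integrable_sq.1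
      h2.integrable_sq.1).trans_le ?_
    exact mul_le_mul h1.le h2.le (integral_nonneg fun _ => sq_nonneg _) h1.nonneg

/-- For the same reason the mean of operator applied to vector is the mean operator applied to the
mean vector. -/
lemma integral_metaGrad (hA : Assumptions D ℓ α L ρ σG σH G) (hα : 0 ≤ α) (hL : 0 ≤ L)
    (hK : 1 ≤ K) (hS : ∀ k, MeasurePreserving (fun ω => S ω k) P (D i))
    (hS' : ∀ k, MeasurePreserving (fun ω => S' ω k) P (D i)) (hI : IndepFun S S' P)
    (w u : Vec d) :
    ∫ ω, metaGrad (ℓ i) α (S ω) (S' ω) w u ∂P = meanMetaGrad D ℓ α i w u := by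
  have h1 := hA.secondMomentLE_id_sub_stochHess hα hL hK hS w
  have h2 := hA.secondMomentLE_stochGrad hK hS' u
  have h := (hA.indepFun_id_sub_stochHess_stochGrad (i := i) hI w u).integral_bilin h1.integrable
    h2.integrable (ContinuousLinearMap.id ℝ (Vec d →L[ℝ] Vec d))
  have h3 : Integrable (fun ω => stochHess (ℓ i) (S ω) w) P := by
    refine ((hA.secondMomentLE_stochHess_sub hK hS w).integrable.add
      (integrable_const (hess (risk D ℓ i) w))).congr (.of_forall fun ω => ?_)
    exact sub_add_cancel _ _
  rw [hA.integral_stochGrad hK hS' u, integral_sub (g := fun ω => α • stochHess (ℓ i) (S ω) w)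
    (integrable_const _) (h3.smul α), integral_smul, hA.integral_stochHess hK hS w] at h
  simpa [metaGrad, meanMetaGrad] using h

end Assumptions

end MiniBatch

/-! ### Which data each quantity of a client depends on. -/

section Client

variable {d n : ℕ} {Z : Type*} {K₀ H K : ℕ}

/-- The slots read before the local iteration with index `h`. -/
def pastSlots (h : ℕ) : Set (Slot K₀ H K) :=
  {s | Sum.elim (fun _ => True) (fun t => (t.1 : ℕ) < h) s}

/-- The slots of those batches of the local iteration `h` whose label lies in `J`. -/
def batchSlots (h : ℕ) (J : Set (Fin 3)) : Set (Slot K₀ H K) :=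
  {s | Sum.elim (fun _ => False) (fun t => (t.1 : ℕ) = h ∧ t.2.1 ∈ J) s}

@[simp] lemma inl_mem_pastSlots (h : ℕ) (k : Fin K₀) :
    (Sum.inl k : Slot K₀ H K) ∈ pastSlots h := trivial

@[simp] lemma inr_mem_pastSlots (h : ℕ) (t : Fin H × Fin 3 × Fin K) :
    (Sum.inr t : Slot K₀ H K) ∈ pastSlots h ↔ (t.1 : ℕ) < h := Iff.rfl

@[simp] lemma inl_mem_batchSlots (h : ℕ) (J : Set (Fin 3)) (k : Fin K₀) :
    (Sum.inl k : Slot K₀ H K) ∈ batchSlots h J ↔ False := Iff.rfl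

@[simp] lemma inr_mem_batchSlots (h : ℕ) (J : Set (Fin 3)) (t : Fin H × Fin 3 × Fin K) :
    (Sum.inr t : Slot K₀ H K) ∈ batchSlots h J ↔ (t.1 : ℕ) = h ∧ t.2.1 ∈ J := Iff.rfl

lemma disjoint_pastSlots_batchSlots (h : ℕ) (J : Set (Fin 3)) :
    Disjoint (pastSlots h : Set (Slot K₀ H K)) (batchSlots h J) := by
  rw [Set.disjoint_left]
  rintro (k | t) h1 h2
  · exact h2
  · simp only [inr_mem_pastSlots, inr_mem_batchSlots] at h1 h2
    omega

lemma disjoint_batchSlots (h : ℕ) {J J' : Set (Fin 3)} (hJ : Disjoint J J') :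
    Disjoint (batchSlots h J : Set (Slot K₀ H K)) (batchSlots h J') := by
  rw [Set.disjoint_left]
  rintro (k | t) h1 h2
  · exact h2
  · exact Set.disjoint_left.1 hJ h1.2 h2.2

/-- The batch with label `j` of the local iteration `h`. -/
def batch (h : Fin H) (j : Fin 3) (x : Slot K₀ H K → Z) : Fin K → Z :=
  fun k => x (Sum.inr (h, j, k))

/-- The stochastic meta-gradient that the client uses in its local iteration `h`. -/
noncomputable def localMetaGrad (f : Vec d → Z → ℝ) (α β η : ℝ) (w : Vec d) (h : Fin H)
    (x : Slot K₀ H K → Z) : Vec d :=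
  metaGrad f α (batch h 1 x) (batch h 2 x) (clientState f α β η w x h.castSucc).1
    (clientState f α β η w x h.succ).2

lemma clientState_zero (f : Vec d → Z → ℝ) (α β η : ℝ) (w : Vec d) (x : Slot K₀ H K → Z) :
    clientState f α β η w x 0 = (w, w - α • stochGrad f (fun k => x (Sum.inl k)) w) := rfl

lemma clientState_succ (f : Vec d → Z → ℝ) (α β η : ℝ) (w : Vec d) (x : Slot K₀ H K → Z)
    (h : Fin H) :
    clientState f α β η w x h.succ =
      localStep f α β η (fun j => batch h j x) (clientState f α β η w x h.castSucc) := by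
  simp only [clientState, Fin.induction_succ]
  rfl

lemma clientState_succ_fst (f : Vec d → Z → ℝ) (α β η : ℝ) (w : Vec d) (x : Slot K₀ H K → Z)
    (h : Fin H) :
    (clientState f α β η w x h.succ).1 =
      (clientState f α β η w x h.castSucc).1 - η • localMetaGrad f α β η w h x := by
  rw [localMetaGrad, clientState_succ]
  rfl

lemma clientState_succ_snd (f : Vec d → Z → ℝ) (α β η : ℝ) (w : Vec d) (x : Slot K₀ H K → Z)
    (h : Fin H) :
    (clientState f α β η w x h.succ).2 =
      personalUpdate f α β (batch h 0 x) (clientState f α β η w x h.castSucc).1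
        (clientState f α β η w x h.castSucc).2 := by
  rw [clientState_succ]
  rfl

lemma clientState_fst_sub (f : Vec d → Z → ℝ) (α β η : ℝ) (w : Vec d) (x : Slot K₀ H K → Z)
    (h : Fin (H + 1)) :
    (clientState f α β η w x h).1 - w =
      (-η) • ∑ j ∈ Finset.univ.filter (fun j : Fin H => j.castSucc < h),
        localMetaGrad f α β η w j x := by
  induction h using Fin.induction with
  | zero => simp [clientState_zero]
  | succ h ih =>
    have : Finset.univ.filter (fun j : Fin H => j.castSucc < h.succ)
        = insert h (Finset.univ.filter (fun j : Fin H => j.castSucc < h.castSucc)) := by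
      ext j
      simp only [Finset.mem_filter, Finset.mem_univ, true_and, Finset.mem_insert,
        Fin.castSucc_lt_castSucc_iff, Fin.castSucc_lt_succ_iff, le_iff_eq_or_lt]
    rw [this, Finset.sum_insert (by simp), smul_add, ← ih, clientState_succ_fst, neg_smul]
    abel

variable [MeasurableSpace Z] {D : Fin n → Measure Z}
  {ℓ : Fin n → Vec d → Z → ℝ} {α β η L ρ σG σH G : ℝ}

/-- Only the slots read before iteration `h` have to be measurable. As the source space is
arbitrary, it may carry the σ-algebra generated by those slots, and the lemma then says that the
client is adapted. -/
lemma Assumptions.measurable_clientState (hA : Assumptions D ℓ α L ρ σG σH G) (i : Fin n)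
    {A : Type*} [MeasurableSpace A] {w : A → Vec d} {x : A → Slot K₀ H K → Z} (hw : Measurable w)
    (h : Fin (H + 1)) (hx : ∀ s ∈ pastSlots (h : ℕ), Measurable fun a => x a s) :
    Measurable fun a => clientState (ℓ i) α β η (w a) (x a) h := by
  induction h using Fin.induction with
  | zero =>
    simp_rw [clientState_zero]
    exact hw.prodMk (hw.sub ((hA.measurable_stochGrad i (fun k => hx _ (by simp)) hw).const_smul α))
  | succ h ih =>
    have ih := ih fun s hs => hx s <| by
      rcases s with k | t
      · simp
      · simp only [inr_mem_pastSlots, Fin.val_castSucc, Fin.val_succ] at hs ⊢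
        omega
    have hb : ∀ j k, Measurable fun a => batch h j (x a) k := fun j k => hx _ (by simp)
    have hu := hA.measurable_personalUpdate i (a := α) (b := β) (hb 0) ih.fst ih.snd
    simp_rw [clientState_succ]
    exact (ih.fst.sub ((hA.measurable_metaGrad i (hb 1) (hb 2) ih.fst hu).const_smul η)).prodMk hu

/-- The law of the data points that a client with data distribution `ν` draws in one round. -/
noncomputable abbrev clientLaw (ν : Measure Z) (K₀ H K : ℕ) : Measure (Slot K₀ H K → Z) :=
  Measure.pi fun _ => ν

lemma iIndepFun_eval (ν : Measure Z) [IsProbabilityMeasure ν] :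
    iIndepFun (fun s (x : Slot K₀ H K → Z) => x s) (clientLaw ν K₀ H K) :=
  iIndepFun_pi (X := fun _ z => z) fun _ => aemeasurable_id

lemma indepFun_of_slots (ν : Measure Z) [IsProbabilityMeasure ν] {U V : Type*}
    [MeasurableSpace U] [MeasurableSpace V] {S T : Set (Slot K₀ H K)} (hST : Disjoint S T)
    {u : (Slot K₀ H K → Z) → U} {v : (Slot K₀ H K → Z) → V}
    (hu : Measurable[familySigma (fun s (x : Slot K₀ H K → Z) => x s) S] u)
    (hv : Measurable[familySigma (fun s (x : Slot K₀ H K → Z) => x s) T] v) :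
    IndepFun u v (clientLaw ν K₀ H K) :=
  indepFun_of_familySigma measurable_pi_apply (iIndepFun_eval ν) hST hu hv

lemma measurePreserving_batch (ν : Measure Z) [IsProbabilityMeasure ν] (h : Fin H) (j : Fin 3)
    (k : Fin K) : MeasurePreserving (fun x => batch h j x k) (clientLaw ν K₀ H K) ν :=
  measurePreserving_eval _ _

lemma measurable_batch (h : Fin H) (j : Fin 3) :
    Measurable (batch (Z := Z) (K₀ := K₀) (K := K) h j) :=
  measurable_pi_iff.2 fun _ => measurable_pi_apply _

lemma measurable_batch_familySigma (h : Fin H) (j : Fin 3) {S : Set (Slot K₀ H K)}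
    (hS : batchSlots (h : ℕ) {j} ⊆ S) :
    Measurable[familySigma (fun s (x : Slot K₀ H K → Z) => x s) S] (batch h j) :=
  @measurable_pi_iff _ _ _ (_) _ _ |>.2 fun k =>
    measurable_familySigma (fun s (x : Slot K₀ H K → Z) => x s) (hS (by simp))

end Client

/-! ### Drift, tracking error and bias of one client. -/

section ClientEstimates

variable {d n : ℕ} {Z : Type*} {K₀ H K : ℕ} [MeasurableSpace Z] {D : Fin n → Measure Z}
  {ℓ : Fin n → Vec d → Z → ℝ} {α β η L ρ σG σH G : ℝ}

/-- A bound for the mean squared tracking error of the personalized model, when the local meta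
model moves by at most `s` in mean square. -/
noncomputable def trackingBound (α β L σG : ℝ) (K₀ : ℕ) (s : ℝ) : ℝ :=
  α ^ 2 * (σG ^ 2 / K₀) + β * (α ^ 2 * σG ^ 2) + (1 + α * L) ^ 2 * s

/-- A bound for the squared bias of the local stochastic meta-gradients. -/
noncomputable def biasBound (α β L ρ σG G : ℝ) (K₀ : ℕ) (s : ℝ) : ℝ :=
  2 * ((α * ρ * G) ^ 2 * s) + 2 * (((1 + α * L) * L) ^ 2 * trackingBound α β L σG K₀ s)

namespace Assumptions

lemma measurable_clientState_apply (hA : Assumptions D ℓ α L ρ σG σH G) (i : Fin n) (w : Vec d)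
    (h : Fin (H + 1)) :
    Measurable fun x : Slot K₀ H K → Z => clientState (ℓ i) α β η w x h :=
  hA.measurable_clientState i measurable_const h fun s _ => measurable_pi_apply s

lemma measurable_clientState_familySigma (hA : Assumptions D ℓ α L ρ σG σH G) (i : Fin n)
    (w : Vec d) (h : Fin (H + 1)) {S : Set (Slot K₀ H K)} (hS : pastSlots (h : ℕ) ⊆ S) :
    Measurable[familySigma (fun s (x : Slot K₀ H K → Z) => x s) S]
      fun x : Slot K₀ H K → Z => clientState (ℓ i) α β η w x h :=
  @Assumptions.measurable_clientState d n Z K₀ H K _ D ℓ α β η L ρ σG σH G hA i _ (_) _ _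
    (@measurable_const _ _ _ (_) _) h
    fun _ hs => measurable_familySigma (fun s (x : Slot K₀ H K → Z) => x s) (hS hs)

lemma indepFun_clientState_batch [∀ i, IsProbabilityMeasure (D i)]
    (hA : Assumptions D ℓ α L ρ σG σH G) (i : Fin n) (w : Vec d) (h : Fin H) :
    IndepFun (fun x => clientState (ℓ i) α β η w x h.castSucc) (batch h 0)
      (clientLaw (D i) K₀ H K) :=
  indepFun_of_slots _ (disjoint_pastSlots_batchSlots h {0})
    (hA.measurable_clientState_familySigma i w h.castSucc subset_rfl)
    (measurable_batch_familySigma h 0 subset_rfl)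

/-- The meta-gradient uses the local model before the step and the personalized model after it. The
latter has already read batch 0 of this iteration, so that batch is counted with the past, and
batches 1 and 2 remain fresh. -/
lemma indepFun_state_batch_pair [∀ i, IsProbabilityMeasure (D i)]
    (hA : Assumptions D ℓ α L ρ σG σH G) (i : Fin n) (w : Vec d) (h : Fin H) :
    IndepFun (fun x => ((clientState (ℓ i) α β η w x h.castSucc).1,
        (clientState (ℓ i) α β η w x h.succ).2)) (fun x => (batch h 1 x, batch h 2 x))
      (clientLaw (D i) K₀ H K) := by
  set S : Set (Slot K₀ H K) := pastSlots (h : ℕ) ∪ batchSlots h {0}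
  set T : Set (Slot K₀ H K) := batchSlots h {1, 2}
  have hST : Disjoint S T := Set.disjoint_union_left.2
    ⟨disjoint_pastSlots_batchSlots h _, disjoint_batchSlots h (by simp)⟩
  have h1 := hA.measurable_clientState_familySigma (β := β) (η := η) i w h.castSucc
    (Set.subset_union_left : _ ⊆ S)
  have h0 := measurable_batch_familySigma (Z := Z) h 0 (Set.subset_union_right : _ ⊆ S)
  have hb : ∀ j ∈ ({1, 2} : Set (Fin 3)),
      Measurable[familySigma (fun s (x : Slot K₀ H K → Z) => x s) T] (batch h j) := fun j hj =>
    measurable_batch_familySigma h j <| by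
      rintro (k | t) ht
      · exact ht
      · simp only [inr_mem_batchSlots, Set.mem_singleton_iff, T] at ht ⊢
        exact ⟨ht.1, ht.2 ▸ hj⟩
  refine indepFun_of_slots _ hST ?_ ((hb 1 (by simp)).prodMk (hb 2 (by simp)))
  simp_rw [clientState_succ_snd]
  refine h1.fst.prodMk ?_
  exact @Assumptions.measurable_personalUpdate d n Z _ K _ (_) D ℓ α L ρ σG σH G hA i α β _ _ _
    (fun k => (measurable_pi_apply k).comp h0) h1.fst h1.snd

lemma stronglyMeasurable_metaGrad (hA : Assumptions D ℓ α L ρ σG σH G) (i : Fin n) :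
    StronglyMeasurable (Function.uncurry fun (p : Vec d × Vec d)
      (q : (Fin K → Z) × (Fin K → Z)) => metaGrad (ℓ i) α q.1 q.2 p.1 p.2) :=
  (hA.measurable_metaGrad i
    (fun k => (measurable_pi_apply k).comp (measurable_fst.comp measurable_snd))
    (fun k => (measurable_pi_apply k).comp (measurable_snd.comp measurable_snd))
    (measurable_fst.comp measurable_fst) (measurable_snd.comp measurable_fst)).stronglyMeasurable

variable [∀ i, IsProbabilityMeasure (D i)]

lemma secondMomentLE_localMetaGrad (hA : Assumptions D ℓ α L ρ σG σH G) (hα : 0 ≤ α)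
    (hL : 0 ≤ L) (hK : 1 ≤ K) (i : Fin n) (w : Vec d) (h : Fin H) :
    SecondMomentLE (localMetaGrad (ℓ i) α β η w h) (metaGradBound α L σG σH G)
      (clientLaw (D i) K₀ H K) :=
  .comp_indep
    (φ := fun (p : Vec d × Vec d) (q : (Fin K → Z) × (Fin K → Z)) =>
      metaGrad (ℓ i) α q.1 q.2 p.1 p.2)
    ((hA.measurable_clientState_apply i w h.castSucc).fst.prodMk
      (hA.measurable_clientState_apply i w h.succ).snd)
    ((measurable_batch h 1).prodMk (measurable_batch h 2))
    (hA.indepFun_state_batch_pair i w h) (hA.stronglyMeasurable_metaGrad i)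
    fun _ => hA.secondMomentLE_metaGrad hα hL hK (measurePreserving_batch _ h 1)
      (measurePreserving_batch _ h 2) (indepFun_of_slots _ (disjoint_batchSlots h (by simp))
        (measurable_batch_familySigma h 1 subset_rfl)
        (measurable_batch_familySigma h 2 subset_rfl)) _ _

lemma integral_localMetaGrad (hA : Assumptions D ℓ α L ρ σG σH G) (hα : 0 ≤ α)
    (hL : 0 ≤ L) (hK : 1 ≤ K) (i : Fin n) (w : Vec d) (h : Fin H) :
    ∫ x, localMetaGrad (ℓ i) α β η w h x ∂(clientLaw (D i) K₀ H K) =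
      ∫ x, meanMetaGrad D ℓ α i (clientState (ℓ i) α β η w x h.castSucc).1
        (clientState (ℓ i) α β η w x h.succ).2 ∂(clientLaw (D i) K₀ H K) := by
  refine (integral_comp_indep
    (φ := fun (p : Vec d × Vec d) (q : (Fin K → Z) × (Fin K → Z)) =>
      metaGrad (ℓ i) α q.1 q.2 p.1 p.2)
    ((hA.measurable_clientState_apply i w h.castSucc).fst.prodMk
      (hA.measurable_clientState_apply i w h.succ).snd)
    ((measurable_batch h 1).prodMk (measurable_batch h 2))
    (hA.indepFun_state_batch_pair i w h) (hA.stronglyMeasurable_metaGrad i)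
    (hA.secondMomentLE_localMetaGrad hα hL hK i w h).integrable).trans ?_
  refine integral_congr_ae (.of_forall fun x => ?_)
  exact hA.integral_metaGrad hα hL hK (measurePreserving_batch _ h 1)
      (measurePreserving_batch _ h 2) (indepFun_of_slots _ (disjoint_batchSlots h (by simp))
        (measurable_batch_familySigma h 1 subset_rfl)
        (measurable_batch_familySigma h 2 subset_rfl)) _ _

/-- The drift is `-η` times a sum of at most `H` meta-gradients. These are dependent, so the cruder
bound by Cauchy–Schwarz is used. -/
lemma secondMomentLE_clientState_fst_sub (hA : Assumptions D ℓ α L ρ σG σH G) (hα : 0 ≤ α)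
    (hL : 0 ≤ L) (hK : 1 ≤ K) (i : Fin n) (w : Vec d) (h : Fin (H + 1)) :
    SecondMomentLE (fun x => (clientState (ℓ i) α β η w x h).1 - w)
      ((η * H) ^ 2 * metaGradBound α L σG σH G) (clientLaw (D i) K₀ H K) := by
  simp_rw [clientState_fst_sub]
  refine ((SecondMomentLE.finset_sum fun j _ =>
    hA.secondMomentLE_localMetaGrad hα hL hK i w j).const_smul (-η)).mono ?_
  rw [neg_sq, mul_pow, mul_assoc]
  have h0 : 0 ≤ metaGradBound α L σG σH G := by unfold metaGradBound; positivity
  gcongr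
  exact (Finset.card_filter_le _ _).trans_eq (by simp)

lemma secondMomentLE_restart (hA : Assumptions D ℓ α L ρ σG σH G) (hK₀ : 1 ≤ K₀)
    (i : Fin n) (w : Vec d) :
    SecondMomentLE (fun x => (clientState (ℓ i) α β η w x 0).2 - idealPersonal D ℓ α i w)
      (α ^ 2 * (σG ^ 2 / K₀)) (clientLaw (D i) K₀ H K) := by
  have h := (hA.secondMomentLE_stochGrad_sub_of_indep (P := clientLaw (D i) K₀ H K)
    (S := fun x k => x (Sum.inl k)) (i := i) hK₀ (fun k => measurePreserving_eval _ _)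
    ((iIndepFun_eval (D i)).precomp Sum.inl_injective) w).const_smul (-α)
  rw [neg_sq] at h
  convert h using 2 with x
  simp only [clientState_zero, idealPersonal]
  module

/-- Induction on the local iteration. The new error is a convex combination of the old error and the
displacement of the ideal model, plus fresh noise of size `β`. The noise is orthogonal to the rest,
so it enters only through `β²`, and contraction by `1 - β` turns this into `β` overall. -/
lemma secondMomentLE_clientState_snd_sub (hA : Assumptions D ℓ α L ρ σG σH G) (hα : 0 ≤ α)
    (hL : 0 ≤ L) (hK : 1 ≤ K) (hK₀ : 1 ≤ K₀) (hβ0 : 0 ≤ β) (hβ1 : β ≤ 1) (i : Fin n)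
    (w : Vec d) (h : Fin (H + 1)) :
    SecondMomentLE (fun x => (clientState (ℓ i) α β η w x h).2 - idealPersonal D ℓ α i w)
      (trackingBound α β L σG K₀ ((η * H) ^ 2 * metaGradBound α L σG σH G))
      (clientLaw (D i) K₀ H K) := by
  set s := (η * H) ^ 2 * metaGradBound α L σG σH G
  have hs : 0 ≤ s := by unfold s metaGradBound; positivity
  induction h using Fin.induction with
  | zero =>
    refine (hA.secondMomentLE_restart hK₀ i w).mono ?_
    unfold trackingBound
    have : 0 ≤ β * (α ^ 2 * σG ^ 2) + (1 + α * L) ^ 2 * s := by positivity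
    linarith
  | succ h ih =>
    -- `a` is the part determined by the past, `ν` the centred noise of the fresh batch.
    set a : Vec d × Vec d → Vec d := fun p => (1 - β) • (p.2 - idealPersonal D ℓ α i w)
      + β • (idealPersonal D ℓ α i p.1 - idealPersonal D ℓ α i w) with ha_def
    set ν : Vec d × Vec d → (Fin K → Z) → Vec d := fun p S =>
      (-(β * α)) • (stochGrad (ℓ i) S p.1 - gradient (risk D ℓ i) p.1) with hν_def
    have hst := hA.measurable_clientState_apply (K₀ := K₀) (K := K) (β := β) (η := η) i w
      h.castSucc
    have hideal : Continuous (idealPersonal D ℓ α i) :=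
      continuous_id.sub ((hA.continuous_gradient_risk i).const_smul α)
    have ha : Measurable a := by
      have : Continuous a := by fun_prop
      exact this.measurable
    have hν : Measurable (Function.uncurry ν) := by
      have h1 : Measurable fun q : (Vec d × Vec d) × (Fin K → Z) =>
          stochGrad (ℓ i) q.2 q.1.1 :=
        hA.measurable_stochGrad i (fun k => (measurable_pi_apply k).comp measurable_snd)
          (measurable_fst.comp measurable_fst)
      have h2 : Measurable fun q : (Vec d × Vec d) × (Fin K → Z) =>
          gradient (risk D ℓ i) q.1.1 :=
        (hA.continuous_gradient_risk i).measurable.comp (measurable_fst.comp measurable_fst)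
      exact (h1.sub h2).const_smul (-(β * α))
    have hI := hA.indepFun_clientState_batch (K₀ := K₀) (K := K) (β := β) (η := η) i w h
    have h1 : SecondMomentLE (fun x => a (clientState (ℓ i) α β η w x h.castSucc))
        ((1 - β) * trackingBound α β L σG K₀ s + β * ((1 + α * L) ^ 2 * s))
        (clientLaw (D i) K₀ H K) :=
      ih.convexComb ((hA.secondMomentLE_clientState_fst_sub hα hL hK i w h.castSucc).mono_norm
        ((hideal.measurable.comp hst.fst).sub measurable_const).aestronglyMeasurable
        fun x => hA.norm_idealPersonal_sub_le hα i _ _) hβ0 hβ1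
    have hν' : ∀ p, SecondMomentLE (fun x => ν p (batch h 0 x)) ((-(β * α)) ^ 2 * σG ^ 2)
        (clientLaw (D i) K₀ H K) := fun p =>
      (hA.secondMomentLE_stochGrad_sub hK (measurePreserving_batch _ h 0) p.1).const_smul _
    have hν0 : ∀ p, ∫ x, ν p (batch h 0 x) ∂(clientLaw (D i) K₀ H K) = 0 := fun p => by
      have hi := (hA.secondMomentLE_stochGrad (P := clientLaw (D i) K₀ H K) hK
        (measurePreserving_batch _ h 0) p.1).integrable
      simp only [hν_def]
      rw [integral_smul, integral_sub hi (integrable_const _),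
        hA.integral_stochGrad hK (measurePreserving_batch _ h 0)]
      simp
    have h2 : SecondMomentLE (fun x => ν (clientState (ℓ i) α β η w x h.castSucc) (batch h 0 x))
        ((-(β * α)) ^ 2 * σG ^ 2) (clientLaw (D i) K₀ H K) :=
      .comp_indep hst (measurable_batch h 0) hI hν.stronglyMeasurable hν'
    have h3 : ∫ x, inner ℝ (a (clientState (ℓ i) α β η w x h.castSucc))
        (ν (clientState (ℓ i) α β η w x h.castSucc) (batch h 0 x))
        ∂(clientLaw (D i) K₀ H K) = 0 := by
      refine (integral_comp_indep (φ := fun p S => inner ℝ (a p) (ν p S)) hst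
        (measurable_batch h 0) hI ?_ (h1.integrable_inner h2)).trans ?_
      · exact ((ha.comp measurable_fst).inner hν).stronglyMeasurable
      · refine integral_eq_zero_of_ae (.of_forall fun x => ?_)
        simp only [Pi.zero_apply]
        rw [integral_inner (hν' _).integrable, hν0, inner_zero_right]
    have e : ∀ x : Slot K₀ H K → Z,
        (clientState (ℓ i) α β η w x h.succ).2 - idealPersonal D ℓ α i w
        = a (clientState (ℓ i) α β η w x h.castSucc)
          + ν (clientState (ℓ i) α β η w x h.castSucc) (batch h 0 x) := fun x => by
      simp only [clientState_succ_snd, personalUpdate, ha_def, hν_def, idealPersonal]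
      module
    simp_rw [e]
    refine (h1.add_of_orthogonal h2 h3).mono ?_
    -- The tracking bound reproduces itself, with slack exactly `β` times this restart term.
    have : 0 ≤ α ^ 2 * (σG ^ 2 / K₀) := by positivity
    unfold trackingBound
    nlinarith [mul_nonneg hβ0 this]

/-- Averaging out the fresh batches leaves the mean meta-gradient at the current pair of models. Its
Lipschitz bound converts drift and tracking error into bias. -/
lemma norm_integral_localMetaGrad_sub_sq_le (hA : Assumptions D ℓ α L ρ σG σH G) (hα : 0 ≤ α)
    (hL : 0 ≤ L) (hρ : 0 ≤ ρ) (hK : 1 ≤ K) (hK₀ : 1 ≤ K₀) (hβ0 : 0 ≤ β) (hβ1 : β ≤ 1)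
    (i : Fin n) (w : Vec d) (h : Fin H) :
    ‖∫ x, localMetaGrad (ℓ i) α β η w h x ∂(clientLaw (D i) K₀ H K)
        - meanMetaGrad D ℓ α i w (idealPersonal D ℓ α i w)‖ ^ 2
      ≤ biasBound α β L ρ σG G K₀ ((η * H) ^ 2 * metaGradBound α L σG σH G) := by
  have h1 := hA.secondMomentLE_clientState_fst_sub (K₀ := K₀) (β := β) (η := η) hα hL hK i w
    h.castSucc
  have h2 := hA.secondMomentLE_clientState_snd_sub (η := η) hα hL hK hK₀ hβ0 hβ1 i w h.succ
  have hm : Measurable fun x : Slot K₀ H K → Z =>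
      meanMetaGrad D ℓ α i (clientState (ℓ i) α β η w x h.castSucc).1
        (clientState (ℓ i) α β η w x h.succ).2 :=
    (hA.continuous_meanMetaGrad hρ i).measurable.comp
      ((hA.measurable_clientState_apply i w h.castSucc).fst.prodMk
        (hA.measurable_clientState_apply i w h.succ).snd)
  have h3 : SecondMomentLE (fun x => meanMetaGrad D ℓ α i
      (clientState (ℓ i) α β η w x h.castSucc).1 (clientState (ℓ i) α β η w x h.succ).2
        - meanMetaGrad D ℓ α i w (idealPersonal D ℓ α i w))
      (biasBound α β L ρ σG G K₀ ((η * H) ^ 2 * metaGradBound α L σG σH G))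
      (clientLaw (D i) K₀ H K) := by
    have := (h1.norm_fun.const_smul (α * ρ * G)).add (h2.norm_fun.const_smul ((1 + α * L) * L))
    have h4 := this.mono_norm (k := 1) (hm.sub measurable_const).aestronglyMeasurable fun x => by
      rw [one_mul]
      exact (hA.norm_meanMetaGrad_sub_le hα hL i _ w _ (idealPersonal D ℓ α i w)).trans
        (le_abs_self _)
    exact h4.mono (by rw [one_pow, one_mul]; rfl)
  have h5 : Integrable (fun x => meanMetaGrad D ℓ α i
      (clientState (ℓ i) α β η w x h.castSucc).1 (clientState (ℓ i) α β η w x h.succ).2)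
      (clientLaw (D i) K₀ H K) :=
    (h3.integrable.add (integrable_const (meanMetaGrad D ℓ α i w (idealPersonal D ℓ α i w)))).congr
      (.of_forall fun x => sub_add_cancel _ _)
  have h6 := h3.norm_integral_sq_le
  rw [integral_sub h5 (integrable_const _), ← hA.integral_localMetaGrad hα hL hK i w h] at h6
  simpa using h6

lemma norm_integral_clientState_sub_add_le (hA : Assumptions D ℓ α L ρ σG σH G) (hα : 0 ≤ α)
    (hL : 0 ≤ L) (hρ : 0 ≤ ρ) (hK : 1 ≤ K) (hK₀ : 1 ≤ K₀) (hβ0 : 0 ≤ β) (hβ1 : β ≤ 1)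
    (hη : 0 ≤ η) (i : Fin n) (w : Vec d) :
    ‖∫ x, ((clientState (ℓ i) α β η w x (Fin.last H)).1 - w) ∂(clientLaw (D i) K₀ H K)
        + (η * H) • meanMetaGrad D ℓ α i w (idealPersonal D ℓ α i w)‖
      ≤ η * H * √(biasBound α β L ρ σG G K₀ ((η * H) ^ 2 * metaGradBound α L σG σH G)) := by
  have e : ∫ x, ((clientState (ℓ i) α β η w x (Fin.last H)).1 - w) ∂(clientLaw (D i) K₀ H K)
        + (η * H) • meanMetaGrad D ℓ α i w (idealPersonal D ℓ α i w)
      = (-η) • ∑ h : Fin H, (∫ x, localMetaGrad (ℓ i) α β η w h x ∂(clientLaw (D i) K₀ H K)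
        - meanMetaGrad D ℓ α i w (idealPersonal D ℓ α i w)) := by
    have hf : Finset.univ.filter (fun j : Fin H => j.castSucc < Fin.last H) = Finset.univ := by
      simp [Fin.castSucc_lt_last]
    simp_rw [clientState_fst_sub, hf]
    rw [integral_smul, integral_finsetSum _ fun h _ =>
      (hA.secondMomentLE_localMetaGrad hα hL hK i w h).integrable, Finset.sum_sub_distrib,
      Finset.sum_const, Finset.card_univ, Fintype.card_fin, ← Nat.cast_smul_eq_nsmul ℝ]
    module
  rw [e, norm_smul, norm_neg, Real.norm_of_nonneg hη, mul_assoc]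
  refine mul_le_mul_of_nonneg_left ((norm_sum_le _ _).trans ?_) hη
  refine (Finset.sum_le_sum fun h _ => Real.le_sqrt_of_sq_le
    (hA.norm_integral_localMetaGrad_sub_sq_le hα hL hρ hK hK₀ hβ0 hβ1 i w h)).trans_eq ?_
  simp

end Assumptions

end ClientEstimates

/-! ### Uniform client sampling. -/

section Sampling

variable {n B : ℕ}

lemma measurableSet_clients (s : Set (Finset (Fin n))) : MeasurableSet s := trivial

lemma isProbabilityMeasure_uniformOn_powersetCard (hBn : B ≤ n) :
    IsProbabilityMeasure (uniformOn
      (Finset.powersetCard B (Finset.univ : Finset (Fin n)) : Set (Finset (Fin n)))) :=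
  isProbabilityMeasure_uniformOn' (Finset.finite_toSet _)
    (Finset.coe_nonempty.2 (Finset.powersetCard_nonempty.2 (by simpa using hBn)))
    (measurableSet_clients _)

lemma uniformOn_powersetCard_mem (hB : 1 ≤ B) (hBn : B ≤ n) (i : Fin n) :
    (uniformOn (Finset.powersetCard B (Finset.univ : Finset (Fin n)) :
      Set (Finset (Fin n)))).real {S | i ∈ S} = B / n := by
  classical
  have hn : 0 < n := by omega
  have e : {S : Finset (Fin n) | i ∈ S}
      = ((Finset.univ.filter (fun S : Finset (Fin n) => ({i} : Finset (Fin n)) ⊆ S) :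
        Finset (Finset (Fin n))) : Set (Finset (Fin n))) := by
    ext S; simp
  rw [Measure.real, e, uniformOn_apply_finset' (measurableSet_clients _)
    (measurableSet_clients _), ← Finset.filter_mem_eq_inter]
  have h1 : ((Finset.powersetCard B (Finset.univ : Finset (Fin n))).filter
      fun S => S ∈ Finset.univ.filter (fun S : Finset (Fin n) => ({i} : Finset (Fin n)) ⊆ S)).card
      = (n - 1).choose (B - 1) := by
    simp only [Finset.mem_filter, Finset.mem_univ, true_and]
    rw [Finset.card_filter_powersetCard_subset _ _ _ (Finset.subset_univ _) (by simpa using hB)]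
    simp
  rw [h1, Finset.card_powersetCard, Finset.card_univ, Fintype.card_fin, ENNReal.toReal_div,
    ENNReal.toReal_natCast, ENNReal.toReal_natCast]
  have h2 : n * (n - 1).choose (B - 1) = n.choose B * B := by
    obtain ⟨m, rfl⟩ := Nat.exists_eq_succ_of_ne_zero hn.ne'
    obtain ⟨b, rfl⟩ := Nat.exists_eq_succ_of_ne_zero (by omega : B ≠ 0)
    exact Nat.add_one_mul_choose_eq m b
  have h3 : (n : ℝ) * (n - 1).choose (B - 1) = n.choose B * B := by exact_mod_cast h2
  have h4 : (0 : ℝ) < n.choose B := by exact_mod_cast Nat.choose_pos hBn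
  have h5 : (0 : ℝ) < n := by exact_mod_cast hn
  rw [div_eq_div_iff h4.ne' h5.ne']
  linarith

variable {Z : Type*} [MeasurableSpace Z] {D : Fin n → Measure Z} [∀ i, IsProbabilityMeasure (D i)]
  {K₀ H K : ℕ}

lemma isProbabilityMeasure_roundLaw (hBn : B ≤ n) :
    IsProbabilityMeasure (roundLaw D B K₀ H K) := by
  have := isProbabilityMeasure_uniformOn_powersetCard hBn
  unfold roundLaw
  infer_instance

lemma ae_card_clients (hBn : B ≤ n) : ∀ᵐ x ∂(roundLaw D B K₀ H K), x.1.card = B := by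
  have := isProbabilityMeasure_uniformOn_powersetCard hBn
  have h : ∀ᵐ S ∂(uniformOn (Finset.powersetCard B (Finset.univ : Finset (Fin n)) :
      Set (Finset (Fin n)))), S.card = B := by
    refine (ae_cond_mem (measurableSet_clients _)).mono fun S hS => ?_
    exact (Finset.mem_powersetCard.1 (Finset.mem_coe.1 hS)).2
  exact Measure.quasiMeasurePreserving_fst.ae h

lemma measurePreserving_client (hBn : B ≤ n) (i : Fin n) :
    MeasurePreserving (fun x : RoundInput n K₀ H K Z => x.2 i) (roundLaw D B K₀ H K)
      (clientLaw (D i) K₀ H K) := by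
  have := isProbabilityMeasure_uniformOn_powersetCard hBn
  exact (measurePreserving_eval (fun i => clientLaw (D i) K₀ H K) i).comp measurePreserving_snd

variable {E : Type*} [NormedAddCommGroup E]

lemma integrable_selected (hBn : B ≤ n) (i : Fin n) {f : (Slot K₀ H K → Z) → E}
    (hf : Integrable f (clientLaw (D i) K₀ H K)) :
    Integrable (fun x : RoundInput n K₀ H K Z => if i ∈ x.1 then f (x.2 i) else 0)
      (roundLaw D B K₀ H K) :=
  (((measurePreserving_client hBn i).integrable_comp_of_integrable hf).indicator
    (measurable_fst (measurableSet_clients {S | i ∈ S}))).congr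
    (.of_forall fun x => by simp [Set.indicator_apply])

/-- Selection and data are independent, so the integral factors into the selection probability and a
client integral. -/
lemma integral_selected [NormedSpace ℝ E] (hB : 1 ≤ B) (hBn : B ≤ n) (i : Fin n)
    (f : (Slot K₀ H K → Z) → E) (hf : AEStronglyMeasurable f (clientLaw (D i) K₀ H K)) :
    ∫ x, (if i ∈ x.1 then f (x.2 i) else 0) ∂(roundLaw D B K₀ H K)
      = ((B : ℝ) / n) • ∫ y, f y ∂(clientLaw (D i) K₀ H K) := by
  have e : ∀ x : RoundInput n K₀ H K Z, (if i ∈ x.1 then f (x.2 i) else 0)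
      = ({S : Finset (Fin n) | i ∈ S}.indicator (fun _ => (1 : ℝ)) x.1) • f (x.2 i) := fun x => by
    by_cases h : i ∈ x.1 <;> simp [h]
  simp_rw [e]
  rw [roundLaw, integral_prod_smul ({S : Finset (Fin n) | i ∈ S}.indicator fun _ => (1 : ℝ))
    (fun y : Fin n → Slot K₀ H K → Z => f (y i)), integral_indicator (measurableSet_clients _),
    integral_comp_measurePreserving
      (measurePreserving_eval (fun i => clientLaw (D i) K₀ H K) i) hf]
  rw [setIntegral_const, uniformOn_powersetCard_mem hB hBn, smul_eq_mul, mul_one]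

end Sampling

/-! ### Expected decrease of the objective in one round. -/

section Round

variable {d n B : ℕ} {Z : Type*} [MeasurableSpace Z] {K₀ H K : ℕ} {D : Fin n → Measure Z}
  {ℓ : Fin n → Vec d → Z → ℝ} {α β η L ρ σG σH G : ℝ}

/-- A bound for the second moment of the movement of the meta model in one round. -/
noncomputable def moveBound (α η L σG σH G : ℝ) (H : ℕ) : ℝ :=
  (η * H) ^ 2 * metaGradBound α L σG σH G

namespace Assumptions

lemma measurable_round (hA : Assumptions D ℓ α L ρ σG σH G) {A : Type*} [MeasurableSpace A]
    {w : A → Vec d} {x : A → RoundInput n K₀ H K Z} (hw : Measurable w) (hx : Measurable x) :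
    Measurable fun a => round ℓ α β η B (w a) (x a) := by
  have e : ∀ a, round ℓ α β η B (w a) (x a) = (B : ℝ)⁻¹ • ∑ i, if i ∈ (x a).1 then
      (clientState (ℓ i) α β η (w a) ((x a).2 i) (Fin.last H)).1 else 0 := fun a => by
    rw [round, Finset.sum_ite_mem, Finset.univ_inter]
  simp_rw [e]
  have h : ∀ i, Measurable fun a => if i ∈ (x a).1 then
      (clientState (ℓ i) α β η (w a) ((x a).2 i) (Fin.last H)).1 else 0 := fun i =>
    Measurable.ite (hx.fst (measurableSet_clients {S | i ∈ S})) ?_ measurable_const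
  · exact (Finset.measurable_fun_sum _ fun i _ => h i).const_smul (B : ℝ)⁻¹
  exact (hA.measurable_clientState i hw _ fun s _ =>
    (measurable_pi_apply s).comp ((measurable_pi_apply i).comp hx.snd)).fst

lemma round_sub_eq (f : Fin n → Vec d) (hB : 1 ≤ B) (w : Vec d) {S : Finset (Fin n)}
    (hS : S.card = B) :
    (B : ℝ)⁻¹ • ∑ i ∈ S, f i - w = (B : ℝ)⁻¹ • ∑ i, if i ∈ S then f i - w else 0 := by
  have hB' : (B : ℝ) ≠ 0 := by positivity
  rw [Finset.sum_ite_mem, Finset.univ_inter, Finset.sum_sub_distrib, smul_sub, Finset.sum_const,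
    hS, ← Nat.cast_smul_eq_nsmul ℝ, inv_smul_smul₀ hB']

variable [∀ i, IsProbabilityMeasure (D i)]

lemma ae_round_sub_eq (hB : 1 ≤ B) (hBn : B ≤ n) (w : Vec d) :
    ∀ᵐ x ∂(roundLaw D B K₀ H K), round ℓ α β η B w x - w = (B : ℝ)⁻¹ • ∑ i, if i ∈ x.1 then
      (clientState (ℓ i) α β η w (x.2 i) (Fin.last H)).1 - w else 0 :=
  (ae_card_clients hBn).mono fun x hx =>
    round_sub_eq (fun i => (clientState (ℓ i) α β η w (x.2 i) (Fin.last H)).1) hB w hx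

/-- The squared norm of an average over `B` clients is at most the average of the squared norms. In
expectation the factor `1 / B` meets the selection probability `B / n` summed over `n` clients, so
both `B` and `n` cancel. -/
lemma secondMomentLE_round_sub (hA : Assumptions D ℓ α L ρ σG σH G) (hα : 0 ≤ α)
    (hL : 0 ≤ L) (hK : 1 ≤ K) (hB : 1 ≤ B) (hBn : B ≤ n) (w : Vec d) :
    SecondMomentLE (fun x => round ℓ α β η B w x - w) (moveBound α η L σG σH G H)
      (roundLaw D B K₀ H K) := by
  have hc := fun i => hA.secondMomentLE_clientState_fst_sub (K₀ := K₀) (β := β) (η := η) hα hL hK i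
    w (Fin.last H)
  have hB' : (B : ℝ) ≠ 0 := by positivity
  have hn : (n : ℝ) ≠ 0 := by
    have : 0 < n := by omega
    positivity
  have hi := fun i => integrable_selected hBn i (hc i).integrable_sq
  refine .of_sq_le (g := fun x => (B : ℝ)⁻¹ * ∑ i, if i ∈ x.1 then
      ‖(clientState (ℓ i) α β η w (x.2 i) (Fin.last H)).1 - w‖ ^ 2 else 0)
    ((hA.measurable_round measurable_const measurable_id).sub
      measurable_const).aestronglyMeasurable
    ((integrable_finsetSum _ fun i _ => hi i).const_mul _) ?_ ?_
  · filter_upwards [ae_round_sub_eq (ℓ := ℓ) (α := α) (β := β) (η := η) hB hBn w,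
      ae_card_clients (D := D) hBn] with x hx hcard
    rw [hx, norm_smul, mul_pow, norm_inv, Real.norm_natCast, Finset.sum_ite_mem,
      Finset.sum_ite_mem, Finset.univ_inter]
    have h1 := (pow_le_pow_left₀ (norm_nonneg _) (norm_sum_le x.1 fun i =>
      (clientState (ℓ i) α β η w (x.2 i) (Fin.last H)).1 - w) 2).trans sq_sum_le_card_mul_sum_sq
    rw [hcard] at h1
    calc _ ≤ ((B : ℝ)⁻¹) ^ 2 * (B * ∑ i ∈ x.1,
          ‖(clientState (ℓ i) α β η w (x.2 i) (Fin.last H)).1 - w‖ ^ 2) :=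
          mul_le_mul_of_nonneg_left h1 (sq_nonneg _)
      _ = _ := by field_simp
  · rw [integral_const_mul, integral_finsetSum _ fun i _ => hi i]
    simp_rw [fun i => integral_selected (D := D) hB hBn i _ (hc i).integrable_sq.1, smul_eq_mul]
    have h2 := Finset.sum_le_sum fun i (_ : i ∈ Finset.univ) =>
      mul_le_mul_of_nonneg_left (hc i).le (by positivity : (0 : ℝ) ≤ (B : ℝ) / n)
    refine (mul_le_mul_of_nonneg_left h2 (by positivity)).trans_eq ?_
    rw [Finset.sum_const, Finset.card_univ, Fintype.card_fin, nsmul_eq_mul, moveBound]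
    field_simp

/-- Sampling is unbiased: the weight `1 / B` times the selection probability `B / n` is `1 / n`. -/
lemma integral_round_sub (hA : Assumptions D ℓ α L ρ σG σH G) (hα : 0 ≤ α)
    (hL : 0 ≤ L) (hK : 1 ≤ K) (hB : 1 ≤ B) (hBn : B ≤ n) (w : Vec d) :
    ∫ x, (round ℓ α β η B w x - w) ∂(roundLaw D B K₀ H K) = (n : ℝ)⁻¹ • ∑ i,
      ∫ y, ((clientState (ℓ i) α β η w y (Fin.last H)).1 - w) ∂(clientLaw (D i) K₀ H K) := by
  have hc := fun i => hA.secondMomentLE_clientState_fst_sub (K₀ := K₀) (β := β) (η := η) hα hL hK i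
    w (Fin.last H)
  have hB' : (B : ℝ) ≠ 0 := by positivity
  have hn : (n : ℝ) ≠ 0 := by
    have : 0 < n := by omega
    positivity
  rw [integral_congr_ae (ae_round_sub_eq hB hBn w), integral_smul,
    integral_finsetSum _ fun i _ => integrable_selected hBn i (hc i).integrable]
  simp_rw [fun i => integral_selected (D := D) hB hBn i _ (hc i).integrable.1]
  rw [← Finset.smul_sum, smul_smul]
  congr 1
  field_simp

lemma inner_integral_round_sub_le (hA : Assumptions D ℓ α L ρ σG σH G) (hα : 0 ≤ α)
    (hL : 0 ≤ L) (hρ : 0 ≤ ρ) (hK : 1 ≤ K) (hK₀ : 1 ≤ K₀) (hB : 1 ≤ B) (hBn : B ≤ n) (hβ0 : 0 ≤ β)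
    (hβ1 : β ≤ 1) (hη : 0 ≤ η) (w : Vec d) :
    inner ℝ (gradient (metaObjective D ℓ α) w)
        (∫ x, (round ℓ α β η B w x - w) ∂(roundLaw D B K₀ H K))
      ≤ -(η * H / 2) * ‖gradient (metaObjective D ℓ α) w‖ ^ 2
        + η * H / 2 * biasBound α β L ρ σG G K₀ (moveBound α η L σG σH G H) := by
  set e := biasBound α β L ρ σG G K₀ (moveBound α η L σG σH G H) with he_def
  have he : 0 ≤ e := by
    unfold e biasBound trackingBound moveBound metaGradBound
    positivity
  set g := gradient (metaObjective D ℓ α) w with hg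
  set v := ∫ x, (round ℓ α β η B w x - w) ∂(roundLaw D B K₀ H K) with hv
  have h1 : ‖v + (η * H) • g‖ ≤ η * H * √e := by
    rw [hv, hg, hA.integral_round_sub hα hL hK hB hBn, hA.gradient_metaObjective, smul_comm,
      ← smul_add, Finset.smul_sum, ← Finset.sum_add_distrib]
    exact norm_average_le (by positivity) fun i =>
      hA.norm_integral_clientState_sub_add_le hα hL hρ hK hK₀ hβ0 hβ1 hη i w
  have h2 : inner ℝ g v = inner ℝ g (v + (η * H) • g) - η * H * ‖g‖ ^ 2 := by
    rw [inner_add_right, inner_smul_right, real_inner_self_eq_norm_sq]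
    ring
  have h3 : inner ℝ g (v + (η * H) • g) ≤ ‖g‖ * (η * H * √e) :=
    (real_inner_le_norm _ _).trans (mul_le_mul_of_nonneg_left h1 (norm_nonneg _))
  -- Young's inequality spends half of the term `η * H * ‖g‖ ^ 2` on absorbing the bias; the other
  -- half drives the descent.
  have h4 := mul_nonneg (by positivity : 0 ≤ η * H) (sq_nonneg (‖g‖ - √e))
  rw [sub_sq, Real.sq_sqrt he] at h4
  rw [h2]
  linarith

lemma integrable_metaObjective_round (hA : Assumptions D ℓ α L ρ σG σH G) (hα : 0 ≤ α)
    (hL : 0 ≤ L) (hK : 1 ≤ K) (hB : 1 ≤ B) (hBn : B ≤ n) (hG : 0 ≤ G) (w : Vec d) :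
    Integrable (fun x => metaObjective D ℓ α (round ℓ α β η B w x)) (roundLaw D B K₀ H K) := by
  have := isProbabilityMeasure_roundLaw (D := D) (K₀ := K₀) (H := H) (K := K) hBn
  have h := hA.secondMomentLE_round_sub (K₀ := K₀) (H := H) (β := β) (η := η) hα hL hK hB hBn w
  have h1 : Integrable (fun x => metaObjective D ℓ α (round ℓ α β η B w x)
      - metaObjective D ℓ α w) (roundLaw D B K₀ H K) :=
    (h.integrable.norm.const_mul ((1 + α * L) * G)).mono'
      (((hA.continuous_metaObjective.measurable.comp
        (hA.measurable_round measurable_const measurable_id)).sub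
          measurable_const).aestronglyMeasurable)
      (.of_forall fun x => hA.abs_metaObjective_sub_le hα hL hG _ _)
  exact (h1.add (integrable_const (metaObjective D ℓ α w))).congr
    (.of_forall fun x => sub_add_cancel _ _)

/-- The expected decrease of the objective in one round that starts from `w`. -/
lemma integral_metaObjective_round_le (hA : Assumptions D ℓ α L ρ σG σH G) (hα : 0 ≤ α)
    (hL : 0 ≤ L) (hρ : 0 ≤ ρ) (hK : 1 ≤ K) (hK₀ : 1 ≤ K₀) (hB : 1 ≤ B) (hBn : B ≤ n) (hβ0 : 0 ≤ β)
    (hβ1 : β ≤ 1) (hη : 0 ≤ η) (hG : 0 ≤ G) (w : Vec d) :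
    ∫ x, metaObjective D ℓ α (round ℓ α β η B w x) ∂(roundLaw D B K₀ H K)
      ≤ metaObjective D ℓ α w - η * H / 2 * ‖gradient (metaObjective D ℓ α) w‖ ^ 2
        + (η * H / 2 * biasBound α β L ρ σG G K₀ (moveBound α η L σG σH G H)
        + (α * ρ * G + (1 + α * L) ^ 2 * L) * moveBound α η L σG σH G H) := by
  have := isProbabilityMeasure_roundLaw (D := D) (K₀ := K₀) (H := H) (K := K) hBn
  have h := hA.secondMomentLE_round_sub (K₀ := K₀) (H := H) (β := β) (η := η) hα hL hK hB hBn w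
  set M := α * ρ * G + (1 + α * L) ^ 2 * L with hM_def
  have hM : 0 ≤ M := by positivity
  set g := gradient (metaObjective D ℓ α) w with hg
  have hi1 : Integrable (fun x => inner ℝ g (round ℓ α β η B w x - w)) (roundLaw D B K₀ H K) :=
    h.integrable.const_inner g
  have hi2 := h.integrable_sq.const_mul M
  have h1 : ∫ x, metaObjective D ℓ α (round ℓ α β η B w x) ∂(roundLaw D B K₀ H K)
      ≤ ∫ x, (metaObjective D ℓ α w + inner ℝ g (round ℓ α β η B w x - w)
        + M * ‖round ℓ α β η B w x - w‖ ^ 2) ∂(roundLaw D B K₀ H K) := by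
    refine integral_mono (hA.integrable_metaObjective_round hα hL hK hB hBn hG w)
      (((integrable_const _).add hi1).add hi2) fun x => ?_
    have := hA.metaObjective_add_le hα hL hρ hG w (round ℓ α β η B w x - w)
    rwa [add_sub_cancel] at this
  rw [integral_add (f := fun x => metaObjective D ℓ α w + inner ℝ g (round ℓ α β η B w x - w))
    ((integrable_const _).add hi1) hi2, integral_add (integrable_const _) hi1,
    integral_const_mul, integral_inner h.integrable] at h1
  simp only [integral_const, probReal_univ, one_smul] at h1
  have h2 := hA.inner_integral_round_sub_le (H := H) hα hL hρ hK hK₀ hB hBn hβ0 hβ1 hη w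
  have h3 := mul_le_mul_of_nonneg_left h.le hM
  linarith

end Assumptions

end Round

/-! ### Telescoping over the rounds. -/

section Iterates

variable {d n B : ℕ} {Z : Type*} [MeasurableSpace Z] {K₀ H K : ℕ} {D : Fin n → Measure Z}
  {ℓ : Fin n → Vec d → Z → ℝ} {α β η L ρ σG σH G : ℝ}

lemma Assumptions.measurable_iterate (hA : Assumptions D ℓ α L ρ σG σH G) {A : Type*}
    [MeasurableSpace A] (w₁ : Vec d) {x : ℕ → A → RoundInput n K₀ H K Z} (r : ℕ)
    (hx : ∀ t < r, Measurable (x t)) :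
    Measurable fun a => iterate ℓ α β η B w₁ (fun t => x t a) r := by
  induction r with
  | zero => exact measurable_const
  | succ r ih =>
    exact hA.measurable_round (ih fun t ht => hx t (by omega)) (hx r (by omega))

/-- A bound for the error terms in the expected decrease of the objective in one round. -/
noncomputable def roundError (α β η L ρ σG σH G : ℝ) (K₀ H : ℕ) : ℝ :=
  η * H / 2 * biasBound α β L ρ σG G K₀ (moveBound α η L σG σH G H)
    + (α * ρ * G + (1 + α * L) ^ 2 * L) * moveBound α η L σG σH G H

variable {Ω : Type*} [MeasurableSpace Ω] {μ : Measure Ω}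
  {X : ℕ → Ω → RoundInput n K₀ H K Z} {W : ℕ → Ω → Vec d} {w₁ : Vec d}

lemma card_slot (K₀ H K : ℕ) : Fintype.card (Slot K₀ H K) = K₀ + H * (3 * K) := by
  simp [Slot]

lemma ae_totalSamples [∀ i, IsProbabilityMeasure (D i)] (hBn : B ≤ n)
    (hX : ∀ r, Measurable (X r))
    (hlaw : ∀ r, μ.map (X r) = roundLaw D B K₀ H K) (R : ℕ) :
    ∀ᵐ ω ∂μ, totalSamples (fun t => X t ω) R = R * (B * (K₀ + H * (3 * K))) := by
  have h : ∀ᵐ ω ∂μ, ∀ r, (X r ω).1.card = B := ae_all_iff.2 fun r => by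
    refine ae_of_ae_map (f := X r) (p := fun x => x.1.card = B) (hX r).aemeasurable ?_
    rw [hlaw r]
    exact ae_card_clients hBn
  filter_upwards [h] with ω hω
  simp only [totalSamples, Finset.sum_const, hω, smul_eq_mul, card_slot, Finset.card_range]

namespace Assumptions

/-- The model at the start of round `r` reads only the inputs of earlier rounds. -/
lemma indepFun_iterate (hA : Assumptions D ℓ α L ρ σG σH G) (hX : ∀ r, Measurable (X r))
    (hI : iIndepFun X μ) (hW : ∀ r ω, W r ω = iterate ℓ α β η B w₁ (fun t => X t ω) r) (r : ℕ) :
    IndepFun (W r) (X r) μ := by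
  have e : W r = fun ω => iterate ℓ α β η B w₁ (fun t => X t ω) r := funext (hW r)
  rw [e]
  refine indepFun_of_familySigma hX hI (S := {t | t < r}) (T := {r}) (by simp) ?_
    (measurable_familySigma X rfl)
  exact @Assumptions.measurable_iterate d n B Z _ K₀ H K D ℓ α β η L ρ σG σH G hA Ω (_) w₁ X r
    fun t ht => measurable_familySigma X ht

lemma integrable_sq_gradient_metaObjective (hA : Assumptions D ℓ α L ρ σG σH G) (hα : 0 ≤ α)
    (hL : 0 ≤ L) (hρ : 0 ≤ ρ) (hG : 0 ≤ G)
    [IsProbabilityMeasure μ] {V : Ω → Vec d} (hV : Measurable V) :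
    Integrable (fun ω => ‖gradient (metaObjective D ℓ α) (V ω)‖ ^ 2) μ :=
  .of_bound (((hA.continuous_gradient_metaObjective hα hL hρ hG).measurable.comp
    hV).norm.pow_const 2).aestronglyMeasurable (((1 + α * L) * G) ^ 2) (.of_forall fun ω => by
      rw [Real.norm_of_nonneg (sq_nonneg _)]
      exact pow_le_pow_left₀ (norm_nonneg _) (hA.norm_gradient_metaObjective_le hα hL hG _) 2)

variable [∀ i, IsProbabilityMeasure (D i)] [IsProbabilityMeasure μ]

lemma secondMomentLE_iterate_succ_sub (hA : Assumptions D ℓ α L ρ σG σH G) (hα : 0 ≤ α)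
    (hL : 0 ≤ L) (hK : 1 ≤ K) (hB : 1 ≤ B) (hBn : B ≤ n) (hX : ∀ r, Measurable (X r))
    (hlaw : ∀ r, μ.map (X r) = roundLaw D B K₀ H K) (hI : iIndepFun X μ)
    (hW : ∀ r ω, W r ω = iterate ℓ α β η B w₁ (fun t => X t ω) r) (r : ℕ) :
    SecondMomentLE (fun ω => W (r + 1) ω - W r ω) (moveBound α η L σG σH G H) μ := by
  have e : ∀ ω, W (r + 1) ω - W r ω = round ℓ α β η B (W r ω) (X r ω) - W r ω := fun ω => by
    rw [hW (r + 1), hW r, iterate]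
  have hWm : Measurable (W r) := by
    rw [show W r = _ from funext (hW r)]
    exact hA.measurable_iterate w₁ r fun t _ => hX t
  have hφ : Measurable fun p : Vec d × RoundInput n K₀ H K Z =>
      round ℓ α β η B p.1 p.2 - p.1 :=
    (hA.measurable_round measurable_fst measurable_snd).sub measurable_fst
  simp_rw [e]
  exact .comp_indep (φ := fun w x => round ℓ α β η B w x - w) hWm (hX r)
    (hA.indepFun_iterate hX hI hW r) hφ.stronglyMeasurable
    fun w => (hA.secondMomentLE_round_sub hα hL hK hB hBn w).comp_measurePreserving
      ⟨hX r, hlaw r⟩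

/-- Induction: each increment of `F` is dominated by a constant times an integrable displacement. -/
lemma integrable_metaObjective_iterate (hA : Assumptions D ℓ α L ρ σG σH G) (hα : 0 ≤ α)
    (hL : 0 ≤ L) (hG : 0 ≤ G) (hK : 1 ≤ K) (hB : 1 ≤ B) (hBn : B ≤ n) (hX : ∀ r, Measurable (X r))
    (hlaw : ∀ r, μ.map (X r) = roundLaw D B K₀ H K) (hI : iIndepFun X μ)
    (hW : ∀ r ω, W r ω = iterate ℓ α β η B w₁ (fun t => X t ω) r) (r : ℕ) :
    Integrable (fun ω => metaObjective D ℓ α (W r ω)) μ := by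
  have hWm : ∀ r, Measurable (W r) := fun r => by
    rw [show W r = _ from funext (hW r)]
    exact hA.measurable_iterate w₁ r fun t _ => hX t
  have hm := hA.continuous_metaObjective.measurable
  induction r with
  | zero => simpa only [hW, iterate] using integrable_const _
  | succ r ih =>
    have h := hA.secondMomentLE_iterate_succ_sub hα hL hK hB hBn hX hlaw hI hW r
    have h1 : Integrable (fun ω => metaObjective D ℓ α (W (r + 1) ω)
        - metaObjective D ℓ α (W r ω)) μ :=
      (h.integrable.norm.const_mul ((1 + α * L) * G)).mono'
        ((hm.comp (hWm (r + 1))).sub (hm.comp (hWm r))).aestronglyMeasurable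
        (.of_forall fun ω => hA.abs_metaObjective_sub_le hα hL hG _ _)
    exact (h1.add ih).congr (.of_forall fun ω => sub_add_cancel _ _)

lemma integral_metaObjective_iterate_succ_le (hA : Assumptions D ℓ α L ρ σG σH G) (hα : 0 ≤ α)
    (hL : 0 ≤ L) (hρ : 0 ≤ ρ) (hG : 0 ≤ G) (hK : 1 ≤ K) (hK₀ : 1 ≤ K₀) (hB : 1 ≤ B) (hBn : B ≤ n)
    (hβ0 : 0 ≤ β) (hβ1 : β ≤ 1) (hη : 0 ≤ η) (hX : ∀ r, Measurable (X r))
    (hlaw : ∀ r, μ.map (X r) = roundLaw D B K₀ H K) (hI : iIndepFun X μ)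
    (hW : ∀ r ω, W r ω = iterate ℓ α β η B w₁ (fun t => X t ω) r) (r : ℕ) :
    η * H / 2 * ∫ ω, ‖gradient (metaObjective D ℓ α) (W r ω)‖ ^ 2 ∂μ
      ≤ ∫ ω, metaObjective D ℓ α (W r ω) ∂μ - ∫ ω, metaObjective D ℓ α (W (r + 1) ω) ∂μ
        + roundError α β η L ρ σG σH G K₀ H := by
  have hWm : Measurable (W r) := by
    rw [show W r = _ from funext (hW r)]
    exact hA.measurable_iterate w₁ r fun t _ => hX t
  have hFi := hA.integrable_metaObjective_iterate hα hL hG hK hB hBn hX hlaw hI hW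
  have hgi := hA.integrable_sq_gradient_metaObjective (μ := μ) hα hL hρ hG hWm
  set e := roundError α β η L ρ σG σH G K₀ H with he
  set F := metaObjective D ℓ α with hF
  -- `c w` is the one-round upper bound for the expected next value of `F` from `w`. Freezing the
  -- model shows that `c` minus the next value has nonnegative mean.
  set c : Vec d → ℝ := fun w => F w - η * H / 2 * ‖gradient F w‖ ^ 2 + e with hc
  have hcm : Measurable c :=
    (hA.continuous_metaObjective.measurable.sub (((hA.continuous_gradient_metaObjective hα hL hρ
      hG).measurable.norm.pow_const 2).const_mul _)).add_const e
  have hφm : Measurable fun p : Vec d × RoundInput n K₀ H K Z =>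
      c p.1 - F (round ℓ α β η B p.1 p.2) :=
    (hcm.comp measurable_fst).sub (hA.continuous_metaObjective.measurable.comp
      (hA.measurable_round measurable_fst measurable_snd))
  have es : ∀ ω, W (r + 1) ω = round ℓ α β η B (W r ω) (X r ω) := fun ω => by
    rw [hW (r + 1), hW r, iterate]
  have hci : Integrable (fun ω => c (W r ω)) μ :=
    ((hFi r).sub (hgi.const_mul _)).add (integrable_const e)
  have hφi : Integrable (fun ω => c (W r ω) - F (round ℓ α β η B (W r ω) (X r ω))) μ := by
    simp_rw [← es]
    exact hci.sub (hFi (r + 1))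
  have h0 : 0 ≤ ∫ ω, (c (W r ω) - F (round ℓ α β η B (W r ω) (X r ω))) ∂μ := by
    rw [integral_comp_indep (φ := fun w x => c w - F (round ℓ α β η B w x)) hWm (hX r)
      (hA.indepFun_iterate hX hI hW r) hφm.stronglyMeasurable hφi]
    refine integral_nonneg fun ω => ?_
    have h1 := hA.integrable_metaObjective_round (K₀ := K₀) (H := H) (β := β) (η := η) hα hL hK hB
      hBn hG (W r ω)
    have hmp : MeasurePreserving (X r) μ (roundLaw D B K₀ H K) := ⟨hX r, hlaw r⟩
    simp only [Pi.zero_apply]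
    rw [integral_sub (g := fun ω' => F (round ℓ α β η B (W r ω) (X r ω')))
      (integrable_const _) (hmp.integrable_comp_of_integrable h1),
      integral_comp_measurePreserving (X := fun x => F (round ℓ α β η B (W r ω) x)) hmp h1.1]
    have h2 := hA.integral_metaObjective_round_le (H := H) hα hL hρ hK hK₀ hB hBn hβ0 hβ1 hη hG
      (W r ω)
    simp only [integral_const, probReal_univ, one_smul, hc]
    simp only [roundError] at he
    linarith
  simp_rw [← es] at h0
  rw [integral_sub hci (hFi (r + 1)), integral_add (f := fun ω => F (W r ω) - η * H / 2 *
    ‖gradient F (W r ω)‖ ^ 2) ((hFi r).sub (hgi.const_mul _)) (integrable_const e),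
    integral_sub (hFi r) (hgi.const_mul _), integral_const_mul] at h0
  simp only [integral_const, probReal_univ, one_smul] at h0
  linarith

/-- The sum over the rounds of the expected decrease of the objective. -/
lemma sum_integral_sq_gradient_le (hA : Assumptions D ℓ α L ρ σG σH G) (hα : 0 ≤ α)
    (hL : 0 ≤ L) (hρ : 0 ≤ ρ) (hG : 0 ≤ G) (hK : 1 ≤ K) (hK₀ : 1 ≤ K₀) (hB : 1 ≤ B) (hBn : B ≤ n)
    (hβ0 : 0 ≤ β) (hβ1 : β ≤ 1) (hη : 0 ≤ η) (hX : ∀ r, Measurable (X r))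
    (hlaw : ∀ r, μ.map (X r) = roundLaw D B K₀ H K) (hI : iIndepFun X μ)
    (hW : ∀ r ω, W r ω = iterate ℓ α β η B w₁ (fun t => X t ω) r) (R : ℕ) :
    η * H / 2 * ∑ r ∈ Finset.range R, ∫ ω, ‖gradient (metaObjective D ℓ α) (W r ω)‖ ^ 2 ∂μ
      ≤ metaObjective D ℓ α w₁ - (⨅ w, metaObjective D ℓ α w)
        + R * roundError α β η L ρ σG σH G K₀ H := by
  have hFi := hA.integrable_metaObjective_iterate hα hL hG hK hB hBn hX hlaw hI hW
  have h1 := Finset.sum_le_sum fun r (_ : r ∈ Finset.range R) =>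
    hA.integral_metaObjective_iterate_succ_le hα hL hρ hG hK hK₀ hB hBn hβ0 hβ1 hη hX hlaw hI hW r
  rw [← Finset.mul_sum, Finset.sum_add_distrib,
    Finset.sum_range_sub' (fun r => ∫ ω, metaObjective D ℓ α (W r ω) ∂μ)] at h1
  -- Boundedness from below ensures that the infimum really bounds the last term of the telescope.
  have h2 : (⨅ w, metaObjective D ℓ α w) ≤ ∫ ω, metaObjective D ℓ α (W R ω) ∂μ := by
    have := integral_mono (μ := μ) (integrable_const (⨅ w, metaObjective D ℓ α w)) (hFi R)
      fun ω => ciInf_le hA.bddBelow (W R ω)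
    simpa using this
  have h3 : ∫ ω, metaObjective D ℓ α (W 0 ω) ∂μ = metaObjective D ℓ α w₁ := by
    simp [hW, iterate]
  rw [h3, Finset.sum_const, Finset.card_range, nsmul_eq_mul] at h1
  linarith

end Assumptions

end Iterates

/-! ### Choice of the parameters. -/

section Constants

/-- The parameter choice makes the average of the bound on the squared gradient norms at most
`ε ^ 2`. -/
lemma exists_parameters {a₁ a₂ a₃ Δ : ℝ} (h₁ : 0 ≤ a₁) (h₂ : 0 ≤ a₂) (h₃ : 0 ≤ a₃) (hΔ : 0 ≤ Δ) :
    ∃ cβ cη cH cR : ℝ, 0 < cβ ∧ cβ ≤ 1 ∧ 0 < cη ∧ 0 < cH ∧ 0 < cR ∧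
      ∀ ε : ℝ, 0 < ε → ε ≤ 1 → ∀ H R : ℝ, cH / ε ^ 2 ≤ H → H ≤ cH / ε ^ 2 + 1 → cR / ε ^ 4 ≤ R →
        2 * Δ / (cη * ε ^ 4 * H * R) + a₁ * (cη * ε ^ 4 * H) ^ 2 + a₂ * (1 / H + cβ * ε ^ 2)
          + a₃ * (cη * ε ^ 4 * H) ≤ ε ^ 2 := by
  -- `q` controls the noise term `a₂`, and `p` the two terms in powers of `η * H`. The summands 1
  -- keep both positive if the problem constants vanish; likewise `8 * Δ + 8` below keeps `R`
  -- positive if `Δ = 0`.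
  obtain ⟨q, hq⟩ : ∃ q, q = 8 * a₂ + 1 := ⟨_, rfl⟩
  obtain ⟨p, hp⟩ : ∃ p, p = 32 * a₁ + 16 * a₃ + 1 := ⟨_, rfl⟩
  have hq1 : 1 ≤ q := by linarith
  have hp1 : 1 ≤ p := by linarith
  have hq0 : 0 < q := by linarith
  have hp0 : 0 < p := by linarith
  refine ⟨1 / q, 1 / (p * q), q, (8 * Δ + 8) * p, by positivity, ?_, by positivity, hq0,
    by positivity, ?_⟩
  · rw [div_le_one hq0]; exact hq1
  intro ε hε hε1 H R hH1 hH2 hR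
  have hε2 : ε ^ 2 ≤ 1 := pow_le_one₀ hε.le hε1
  have hε2' : 0 < ε ^ 2 := by positivity
  have hH : 0 < H := lt_of_lt_of_le (by positivity) hH1
  have hqH : q ≤ H * ε ^ 2 := (div_le_iff₀ hε2').1 hH1
  -- `x` is the effective step size `η * H`. Since `H * ε ^ 2` lies between `q` and `2 * q`,
  -- rounding included, `x * p` lies between `ε ^ 2` and `2 * ε ^ 2`.
  obtain ⟨x, hx⟩ : ∃ x, x = 1 / (p * q) * ε ^ 4 * H := ⟨_, rfl⟩
  have hx' : x * p * q = ε ^ 2 * (H * ε ^ 2) := by rw [hx]; field_simp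
  have hxl : ε ^ 2 ≤ x * p := by
    have h := mul_le_mul_of_nonneg_left hqH hε2'.le
    rw [← hx'] at h
    exact le_of_mul_le_mul_right h hq0
  have hHu : H * ε ^ 2 ≤ 2 * q := by
    have h := mul_le_mul_of_nonneg_right hH2 hε2'.le
    rw [add_mul, div_mul_cancel₀ _ hε2'.ne'] at h
    linarith
  have hxu : x * p ≤ 2 * ε ^ 2 := by
    have h := mul_le_mul_of_nonneg_left hHu hε2'.le
    rw [← hx'] at h
    refine le_of_mul_le_mul_right ?_ hq0
    linarith
  have hx0 : 0 < x := by rw [hx]; positivity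
  have hR' : (8 * Δ + 8) * p ≤ R * ε ^ 4 := (div_le_iff₀ (by positivity)).1 hR
  have hR0 : 0 < R := lt_of_lt_of_le (by positivity) hR
  rw [← hx]
  -- Error budget: a quarter of `ε ^ 2` for the initial gap and an eighth for each of the four other
  -- terms.
  have t1 : 2 * Δ / (x * R) ≤ ε ^ 2 / 4 := by
    rw [div_le_iff₀ (by positivity)]
    have h1 : (8 * Δ + 8) * ε ^ 2 ≤ x * R * ε ^ 4 := by
      calc (8 * Δ + 8) * ε ^ 2 ≤ (8 * Δ + 8) * (x * p) :=
            mul_le_mul_of_nonneg_left hxl (by positivity)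
        _ = x * ((8 * Δ + 8) * p) := by ring
        _ ≤ x * (R * ε ^ 4) := mul_le_mul_of_nonneg_left hR' hx0.le
        _ = _ := by ring
    have h2 : (8 * Δ + 8) ≤ x * R * ε ^ 2 := by
      refine le_of_mul_le_mul_right ?_ hε2'
      calc _ ≤ _ := h1
        _ = _ := by ring
    linarith
  have hxp : x * (32 * a₁) + x * (16 * a₃) + x ≤ 2 * ε ^ 2 := by
    rw [hp] at hxu
    linarith
  have hxa1 : 0 ≤ x * a₁ := by positivity
  have hxa3 : 0 ≤ x * a₃ := by positivity
  have t2 : a₁ * x ^ 2 ≤ ε ^ 2 / 8 := by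
    have hx2 : x ≤ 2 := by linarith
    have := mul_le_mul_of_nonneg_left hx2 hxa1
    linarith
  have t3 : a₃ * x ≤ ε ^ 2 / 8 := by linarith
  have t4 : a₂ * (1 / H) ≤ ε ^ 2 / 8 := by
    rw [mul_one_div, div_le_iff₀ hH]
    linarith
  have t5 : a₂ * (1 / q * ε ^ 2) ≤ ε ^ 2 / 8 := by
    have h : a₂ * (1 / q) ≤ 1 / 8 := by
      rw [mul_one_div, div_le_iff₀ hq0]
      linarith
    have := mul_le_mul_of_nonneg_right h hε2'.le
    linarith
  rw [mul_add]
  linarith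

/-- Sum `2 * ε * a r ≤ a r ^ 2 + ε ^ 2` over the rounds. -/
lemma average_le_of_average_sq_le {R : ℕ} (hR : 0 < R) {a b : ℕ → ℝ} {ε : ℝ} (hε : 0 < ε)
    (hab : ∀ r, a r ^ 2 ≤ b r) (hb : (R : ℝ)⁻¹ * ∑ r ∈ Finset.range R, b r ≤ ε ^ 2) :
    (R : ℝ)⁻¹ * ∑ r ∈ Finset.range R, a r ≤ ε := by
  have hR' : (0 : ℝ) < R := by exact_mod_cast hR
  have h1 : ∑ r ∈ Finset.range R, 2 * ε * a r ≤ ∑ r ∈ Finset.range R, (b r + ε ^ 2) :=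
    Finset.sum_le_sum fun r _ => by nlinarith [hab r, sq_nonneg (a r - ε)]
  rw [← Finset.mul_sum, Finset.sum_add_distrib, Finset.sum_const, Finset.card_range,
    nsmul_eq_mul] at h1
  rw [inv_mul_le_iff₀ hR'] at hb ⊢
  have h2 : 2 * ε * ∑ r ∈ Finset.range R, a r ≤ 2 * ε * (R * ε) := by linarith
  exact le_of_mul_le_mul_left h2 (by positivity)

end Constants

/-! ### Assembly of the bounds. -/

section Main

/-- With `K₀ = H` the restart variance becomes the `1 / H` term. Factoring out `η * H / 2` exposes
the coefficients of the powers of `η * H` that `exists_parameters` takes as input. -/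
lemma roundError_eq (α β η L ρ σG σH G : ℝ) (H : ℕ) :
    roundError α β η L ρ σG σH G H H = η * H / 2 *
      ((2 * (α * ρ * G) ^ 2 + 2 * ((1 + α * L) * L) ^ 2 * (1 + α * L) ^ 2)
          * metaGradBound α L σG σH G * (η * H) ^ 2
        + 2 * ((1 + α * L) * L) ^ 2 * (α ^ 2 * σG ^ 2) * (1 / H + β)
        + 2 * (α * ρ * G + (1 + α * L) ^ 2 * L) * metaGradBound α L σG σH G * (η * H)) := by
  unfold roundError biasBound trackingBound moveBound
  ring

lemma average_le_of_sum_le {x R S Δ e ε : ℝ} (hx : 0 < x) (hR : 0 < R)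
    (h : x / 2 * S ≤ Δ + R * (x / 2 * e)) (he : 2 * Δ / (x * R) + e ≤ ε) : R⁻¹ * S ≤ ε := by
  refine le_trans ?_ he
  rw [inv_mul_le_iff₀ hR]
  have e1 : R * (2 * Δ / (x * R) + e) = 2 * Δ / x + R * e := by field_simp
  rw [e1, ← sub_le_iff_le_add, le_div_iff₀ hx]
  linarith

end Main

end LocalMOML

theorem mainTheorem4
    (α L ρ σG σH G Δ : ℝ) (hα : 0 ≤ α) (hL : 0 ≤ L) (hρ : 0 ≤ ρ) (hσG : 0 ≤ σG) (hσH : 0 ≤ σH)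
    (hG : 0 ≤ G) (hΔ : 0 ≤ Δ) (B K : ℕ) (hB : 1 ≤ B) (hK : 1 ≤ K) :
    -- constants that depend only on the problem parameters above
    ∃ cβ cη cH cR C : ℝ, 0 < cβ ∧ cβ ≤ 1 ∧ 0 < cη ∧ 0 < cH ∧ 0 < cR ∧ 0 < C ∧
      ∀ (d n : ℕ) (_ : B < n) (Z : Type*) (_ : MeasurableSpace Z) (D : Fin n → Measure Z)
        (_ : ∀ i, IsProbabilityMeasure (D i)) (ℓ : Fin n → LocalMOML.Vec d → Z → ℝ)
        (_ : LocalMOML.Assumptions D ℓ α L ρ σG σH G)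
        (w₁ : LocalMOML.Vec d)
        (_ : LocalMOML.metaObjective D ℓ α w₁ - (⨅ w, LocalMOML.metaObjective D ℓ α w) ≤ Δ)
        (ε : ℝ) (_ : 0 < ε) (_ : ε ≤ 1)
        (β η : ℝ) (H K₀ R : ℕ)
        (_ : β = cβ * ε ^ 2) (_ : η = cη * ε ^ 4) (_ : H = ⌈cH / ε ^ 2⌉₊) (_ : K₀ = H)
        (_ : R = ⌈cR / ε ^ 4⌉₊)
        (Ω : Type*) (_ : MeasurableSpace Ω) (μ : Measure Ω) (_ : IsProbabilityMeasure μ)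
        (X : ℕ → Ω → LocalMOML.RoundInput n K₀ H K Z) (_ : ∀ r, Measurable (X r))
        (_ : ∀ r, μ.map (X r) = LocalMOML.roundLaw D B K₀ H K) (_ : iIndepFun X μ)
        (W : ℕ → Ω → LocalMOML.Vec d)
        (_ : ∀ r ω, W r ω = LocalMOML.iterate ℓ α β η B w₁ (fun t => X t ω) r),
        -- stationarity of the models `W 0, …, W (R - 1)` at the start of the `R` rounds
        (∀ r, Integrable (fun ω => ‖gradient (LocalMOML.metaObjective D ℓ α) (W r ω)‖ ^ 2) μ) ∧
        (R : ℝ)⁻¹ * ∑ r ∈ Finset.range R,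
            ∫ ω, ‖gradient (LocalMOML.metaObjective D ℓ α) (W r ω)‖ ^ 2 ∂μ ≤ ε ^ 2 ∧
        (R : ℝ)⁻¹ * ∑ r ∈ Finset.range R,
            ∫ ω, ‖gradient (LocalMOML.metaObjective D ℓ α) (W r ω)‖ ∂μ ≤ ε ∧
        (∃ r < R, ∫ ω, ‖gradient (LocalMOML.metaObjective D ℓ α) (W r ω)‖ ∂μ ≤ ε) ∧
        -- communication rounds, and iterations `T = R * H`
        (R : ℝ) ≤ C / ε ^ 4 ∧
        ((R * H : ℕ) : ℝ) ≤ C / ε ^ 6 ∧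
        -- average number of data points per iteration of a selected client
        (Fintype.card (LocalMOML.Slot K₀ H K) : ℝ) / H = 1 + 3 * K ∧
        -- data points drawn in total, and on average per iteration, by all selected clients
        (∀ᵐ ω ∂μ,
          (LocalMOML.totalSamples (fun t => X t ω) R : ℝ) ≤ C / ε ^ 6 ∧
          (LocalMOML.totalSamples (fun t => X t ω) R : ℝ) / ((R * H : ℕ) : ℝ)
            = B * (1 + 3 * K)) := by
  have hm : 0 ≤ LocalMOML.metaGradBound α L σG σH G := by
    unfold LocalMOML.metaGradBound
    positivity
  obtain ⟨cβ, cη, cH, cR, hcβ, hcβ1, hcη, hcH, hcR, hpar⟩ :=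
    LocalMOML.exists_parameters
      (a₁ := (2 * (α * ρ * G) ^ 2 + 2 * ((1 + α * L) * L) ^ 2 * (1 + α * L) ^ 2)
        * LocalMOML.metaGradBound α L σG σH G)
      (a₂ := 2 * ((1 + α * L) * L) ^ 2 * (α ^ 2 * σG ^ 2))
      (a₃ := 2 * (α * ρ * G + (1 + α * L) ^ 2 * L) * LocalMOML.metaGradBound α L σG σH G)
      (Δ := Δ) (by positivity) (by positivity) (by positivity) hΔ
  have hB' : (1 : ℝ) ≤ B := by exact_mod_cast hB
  have hK' : (1 : ℝ) ≤ 1 + 3 * K := by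
    have : (0 : ℝ) ≤ K := by positivity
    linarith
  have hBK : (1 : ℝ) ≤ B * (1 + 3 * K) := one_le_mul_of_one_le_of_one_le hB' hK'
  -- The summands 1 in `C` pay for rounding up `R` and `H`, as `ε ≤ 1`; the last factor is the data
  -- cost per iteration, at least 1, so one constant serves all three budgets.
  refine ⟨cβ, cη, cH, cR, (cR + 1) * (cH + 1) * (B * (1 + 3 * K)), hcβ, hcβ1, hcη, hcH, hcR,
    by positivity, ?_⟩
  intro d n hBn Z _ D _ ℓ hA w₁ hw₁ ε hε hε1 β η H K₀ R hβ hη hH hK₀ hR Ω _ μ _ X hX hlaw hI W hW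
  subst hK₀
  have hε2 : 0 < ε ^ 2 := by positivity
  have hε4 : 0 < ε ^ 4 := by positivity
  have hH1 : cH / ε ^ 2 ≤ K₀ := hH ▸ Nat.le_ceil _
  have hH2 : (K₀ : ℝ) ≤ cH / ε ^ 2 + 1 := hH ▸ (Nat.ceil_lt_add_one (by positivity)).le
  have hR1 : cR / ε ^ 4 ≤ R := hR ▸ Nat.le_ceil _
  have hR2 : (R : ℝ) ≤ cR / ε ^ 4 + 1 := hR ▸ (Nat.ceil_lt_add_one (by positivity)).le
  have hHpos : (0 : ℝ) < K₀ := lt_of_lt_of_le (by positivity) hH1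
  have hRpos : (0 : ℝ) < R := lt_of_lt_of_le (by positivity) hR1
  have hH0 : 1 ≤ K₀ := by exact_mod_cast hHpos
  have hR0 : 0 < R := by exact_mod_cast hRpos
  have hη0 : 0 < η := by rw [hη]; positivity
  have hβ0 : 0 ≤ β := by rw [hβ]; positivity
  have hβ1 : β ≤ 1 := by
    rw [hβ]
    exact mul_le_one₀ hcβ1 hε2.le (pow_le_one₀ hε.le hε1)
  have hWm : ∀ r, Measurable (W r) := fun r => by
    rw [show W r = _ from funext (hW r)]
    exact hA.measurable_iterate w₁ r fun t _ => hX t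
  have hint : ∀ r, Integrable
      (fun ω => ‖gradient (LocalMOML.metaObjective D ℓ α) (W r ω)‖ ^ 2) μ := fun r =>
    hA.integrable_sq_gradient_metaObjective hα hL hρ hG (hWm r)
  have hsum := hA.sum_integral_sq_gradient_le hα hL hρ hG hK hH0 hB hBn.le hβ0 hβ1 hη0.le hX hlaw
    hI hW R
  rw [LocalMOML.roundError_eq] at hsum
  have havg : (R : ℝ)⁻¹ * ∑ r ∈ Finset.range R,
      ∫ ω, ‖gradient (LocalMOML.metaObjective D ℓ α) (W r ω)‖ ^ 2 ∂μ ≤ ε ^ 2 := by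
    refine LocalMOML.average_le_of_sum_le (mul_pos hη0 hHpos) hRpos
      (hsum.trans (add_le_add_left hw₁ _)) ?_
    have h := hpar ε hε hε1 K₀ R hH1 hH2 hR1
    rw [← hη, ← hβ] at h
    linarith
  have havg1 : (R : ℝ)⁻¹ * ∑ r ∈ Finset.range R,
      ∫ ω, ‖gradient (LocalMOML.metaObjective D ℓ α) (W r ω)‖ ∂μ ≤ ε := by
    refine LocalMOML.average_le_of_average_sq_le hR0 hε (fun r => ?_) havg
    have hm : AEStronglyMeasurable
        (fun ω => gradient (LocalMOML.metaObjective D ℓ α) (W r ω)) μ :=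
      ((hA.continuous_gradient_metaObjective hα hL hρ hG).measurable.comp
        (hWm r)).aestronglyMeasurable
    -- Jensen for the gradient norm, with its own second moment as the bound.
    have h := (LocalMOML.SecondMomentLE.of_sq_le hm (hint r) (.of_forall fun _ => le_rfl)
      le_rfl).norm_fun.norm_integral_sq_le
    rwa [Real.norm_eq_abs, sq_abs] at h
  have hRC : (R : ℝ) ≤ (cR + 1) / ε ^ 4 := by
    refine hR2.trans ?_
    rw [add_div]
    have : 1 ≤ 1 / ε ^ 4 := one_le_one_div hε4 (pow_le_one₀ hε.le hε1)
    linarith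
  have hHC : (K₀ : ℝ) ≤ (cH + 1) / ε ^ 2 := by
    refine hH2.trans ?_
    rw [add_div]
    have : 1 ≤ 1 / ε ^ 2 := one_le_one_div hε2 (pow_le_one₀ hε.le hε1)
    linarith
  have hRH : (R : ℝ) * K₀ ≤ (cR + 1) * (cH + 1) / ε ^ 6 := by
    refine (mul_le_mul hRC hHC hHpos.le (by positivity)).trans_eq ?_
    rw [div_mul_div_comm, ← pow_add]
  refine ⟨hint, havg, havg1, ?_, ?_, ?_, ?_, ?_⟩
  · have h : ∑ r ∈ Finset.range R, ∫ ω, ‖gradient (LocalMOML.metaObjective D ℓ α) (W r ω)‖ ∂μ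
        ≤ ∑ _r ∈ Finset.range R, ε := by
      rw [inv_mul_le_iff₀ hRpos] at havg1
      simpa using havg1
    obtain ⟨r, hr, hle⟩ := Finset.exists_le_of_sum_le (by simpa using hR0.ne') h
    exact ⟨r, Finset.mem_range.1 hr, hle⟩
  · refine hRC.trans (div_le_div_of_nonneg_right ?_ hε4.le)
    rw [mul_assoc]
    exact le_mul_of_one_le_right (by positivity)
      (one_le_mul_of_one_le_of_one_le (by linarith) hBK)
  · push_cast
    exact hRH.trans (div_le_div_of_nonneg_right (le_mul_of_one_le_right (by positivity) hBK)
      (by positivity))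
  · rw [LocalMOML.card_slot]
    push_cast
    field_simp
  · filter_upwards [LocalMOML.ae_totalSamples hBn.le hX hlaw R] with ω hω
    rw [hω]
    push_cast
    constructor
    · calc (R : ℝ) * (B * (K₀ + K₀ * (3 * K))) = R * K₀ * (B * (1 + 3 * K)) := by ring
        _ ≤ (cR + 1) * (cH + 1) / ε ^ 6 * (B * (1 + 3 * K)) :=
          mul_le_mul_of_nonneg_right hRH (by positivity)
        _ = _ := by ring
    · field_simp
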